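/- All data are rational and encoded in binary, and polynomial time means time polynomial in the bit size of the input (formally, on a random access machine with logarithmic cost). A facility-location space consists of a finite set $F\neq\emptyset$ of facilities, a finite set $C$ of clients, and a (pseudo)metric $c$ on $F\cup C$ (distinct points may be co-located). An instance of 2-stage facility location has in addition first- and second-stage opening costs $f_i,f^{II}_i\ge 0$ for $i\in F$. In the $k$-bounded setting the scenarios are the sets in $\mathcal A=\{A\subseteq C:|A|\le k\}$. For an integral first-stage decision $x\in X=\{0,1\}^F$ and a scenario $A$, let $g(x,A)$ be the optimal fractional second-stage cost, that is, $$g(x,A)=\min\Bigl\{\sum_{i\in F} f^{II}_iz_i+\sum_{j\in A}\sum_{i\in F}c_{ij}w_{ij}\ :\ \sum_{i\in F} w_{ij}\ge 1\ (j\in A),\ \ w_{ij}\le x_i+z_i\ (i\in F,\,j\in A),\ \ z,w\ge 0\Bigr\}.$$ Let $\sigma$ be one of the two scenario metrics $$\sigma^{\mathrm{disc}}(A,A')=\begin{cases}0&A=A'\\1&A\ne A'\end{cases},\qquad \sigma^{\mathrm{asym}}_\infty(A,A')=\max_{j'\in A'}\min_{j\in A}c_{j'j},$$ where a minimum over the empty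 set is $\infty$, a maximum over the empty set is $0$, and $0\cdot\infty=0$. For $\beta_1,\beta_2\ge 1$, a $(\beta_1,\beta_2)$-approximation algorithm for $g(x,y,A)=\max_{A'\in\mathcal A}\bigl(g(x,A')-y\,\sigma(A,A')\bigr)$ is an algorithm that, given the instance, $k$, and $(x,y,A)\in X\times\mathbb Q_{\ge 0}\times\mathcal A$, returns a scenario $\bar A\in\mathcal A$ with $$g(x,\bar A)-y\,\sigma(A,\bar A)\ \ge\ \frac{g(x,A')}{\beta_1}-\beta_2\,y\,\sigma(A,A')\qquad\text{for all }A'\in\mathcal A.$$ An instance of $k$-max-min facility location consists of a facility-location space, opening costs $f_i\ge 0$ for $i\in F$, and $k\in\mathbb N$; the problem is to find $A\subseteq C$ with $|A|\le k$ that maximizes the optimal cost of serving $A$. This cost is, in the fractional version, the minimum of $\sum_i f_iz_i+\sum_{j\in A}\sum_i c_{ij}w_{ij}$ subject to $\sum_i w_{ij}\ge1$ for $j\in A$, $w_{ij}\le z_i$ for $i\in F$, $j\in A$, and $z,w\ge0$; in the integral version it is the minimum of $\sum_{i\in T}f_i+\sum_{j\in A}c_{\varphi(j)j}$ over all $T\subseteq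 F$ and $\varphi:A\to T$. The Pál–Tardos cost share of a client $j$ in a set $J\ni j$ of clients is $$\xi(J,j)=\min_{i\in F}\max\{t(J,i),c_{ij}\},\qquad t(J,i)=\min\Bigl\{t\ge0:\ \sum_{j\in J}\max\{0,t-c_{ij}\}\ge f_i\Bigr\}.$$ The greedy algorithm starts from $J_0=\emptyset$, sets $J_t=J_{t-1}\cup\{j\}$ in step $t=1,\dots,\min\{k,|C|\}$, where $j\in C\setminus J_{t-1}$ maximizes $\xi(J_{t-1}\cup\{j\},j)$ (ties are broken arbitrarily), and returns the last set. **Theorem.** (i) For 2-stage facility location in the $k$-bounded setting, with $\sigma$ being either $\sigma^{\mathrm{disc}}$ or $\sigma^{\mathrm{asym}}_\infty$, there is a polynomial-time $(6,1)$-approximation algorithm for computing $g(x,y,A)$. (ii) The greedy algorithm can be implemented to run in polynomial time. However ties are broken, its output is a $6$-approximate solution both to $k$-max-min fractional facility location and to $k$-max-min integral facility location: it has at most $k$ clients, and its cost is at least $\frac16$ of the cost of every set of at most $k$ clients, for the fractional as well as for the integral cost. -/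

import Mathlib

open scoped ENNReal

/-! ### A random access machine with logarithmic cost -/

namespace RAM

/-- The number of bits used to write an integer, including its sign. -/
def bitLen (z : ℤ) : ℕ := z.natAbs.size + 1

/-- A memory: integer registers `reg v` and integer arrays `arr a`, whose cells `arr a i` can be
addressed indirectly. A program mentions only finitely many registers and arrays. -/
structure State where
  reg : ℕ → ℤ
  arr : ℕ → ℤ → ℤ

/-- Arithmetic expressions over the memory; `div` is integer division. -/
inductive Expr where
  | const (z : ℤ)
  | reg (v : ℕ)
  | read (a : ℕ) (i : Expr)
  | add (e₁ e₂ : Expr)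
  | sub (e₁ e₂ : Expr)
  | mul (e₁ e₂ : Expr)
  | div (e₁ e₂ : Expr)

/-- The value of an expression. -/
def Expr.eval (s : State) : Expr → ℤ
  | .const z => z
  | .reg v => s.reg v
  | .read a i => s.arr a (i.eval s)
  | .add e₁ e₂ => e₁.eval s + e₂.eval s
  | .sub e₁ e₂ => e₁.eval s - e₂.eval s
  | .mul e₁ e₂ => e₁.eval s * e₂.eval s
  | .div e₁ e₂ => e₁.eval s / e₂.eval s

/-- The logarithmic cost of evaluating an expression: every operation is charged the bit length of
its result, on top of the cost of its operands (and hence of their bit lengths). -/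
def Expr.cost (s : State) : Expr → ℕ
  | .const z => bitLen z
  | .reg v => bitLen (s.reg v)
  | .read a i => i.cost s + bitLen (s.arr a (i.eval s))
  | .add e₁ e₂ => e₁.cost s + e₂.cost s + bitLen (e₁.eval s + e₂.eval s)
  | .sub e₁ e₂ => e₁.cost s + e₂.cost s + bitLen (e₁.eval s - e₂.eval s)
  | .mul e₁ e₂ => e₁.cost s + e₂.cost s + bitLen (e₁.eval s * e₂.eval s)
  | .div e₁ e₂ => e₁.cost s + e₂.cost s + bitLen (e₁.eval s / e₂.eval s)

/-- Programs; `loop e c` repeats `c` as long as `e` is positive, and `ite e c₁ c₂` runs `c₁` if `e` is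
positive and `c₂` otherwise. -/
inductive Program where
  | skip
  | assign (v : ℕ) (e : Expr)
  | write (a : ℕ) (i e : Expr)
  | seq (c₁ c₂ : Program)
  | ite (e : Expr) (c₁ c₂ : Program)
  | loop (e : Expr) (c : Program)

/-- The memory after setting register `v` to `z`. -/
def State.setReg (s : State) (v : ℕ) (z : ℤ) : State :=
  { s with reg := Function.update s.reg v z }

/-- The memory after setting cell `i` of array `a` to `z`. -/
def State.setArr (s : State) (a : ℕ) (i z : ℤ) : State :=
  { s with arr := Function.update s.arr a (Function.update (s.arr a) i z) }

/-- `Exec c s s' t`: the program `c`, started with memory `s`, halts with memory `s'` after running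
for time `t`. -/
inductive Exec : Program → State → State → ℕ → Prop where
  | skip (s : State) : Exec .skip s s 1
  | assign (s : State) (v : ℕ) (e : Expr) :
      Exec (.assign v e) s (s.setReg v (e.eval s)) (e.cost s + 1)
  | write (s : State) (a : ℕ) (i e : Expr) :
      Exec (.write a i e) s (s.setArr a (i.eval s) (e.eval s)) (i.cost s + e.cost s + 1)
  | seq {c₁ c₂ : Program} {s s' s'' : State} {t₁ t₂ : ℕ} :
      Exec c₁ s s' t₁ → Exec c₂ s' s'' t₂ → Exec (.seq c₁ c₂) s s'' (t₁ + t₂)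
  | ite_pos {e : Expr} {c₁ c₂ : Program} {s s' : State} {t : ℕ} :
      0 < e.eval s → Exec c₁ s s' t → Exec (.ite e c₁ c₂) s s' (e.cost s + 1 + t)
  | ite_neg {e : Expr} {c₁ c₂ : Program} {s s' : State} {t : ℕ} :
      e.eval s ≤ 0 → Exec c₂ s s' t → Exec (.ite e c₁ c₂) s s' (e.cost s + 1 + t)
  | loop_stop {e : Expr} {c : Program} {s : State} :
      e.eval s ≤ 0 → Exec (.loop e c) s s (e.cost s + 1)
  | loop_step {e : Expr} {c : Program} {s s' s'' : State} {t₁ t₂ : ℕ} :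
      0 < e.eval s → Exec c s s' t₁ → Exec (.loop e c) s' s'' t₂ →
        Exec (.loop e c) s s'' (e.cost s + 1 + t₁ + t₂)

/-- Executions are deterministic: the final memory and the running time are determined by the
program and the initial memory. -/
theorem Exec.deterministic {c : Program} {s s₁ s₂ : State} {t₁ t₂ : ℕ}
    (h₁ : Exec c s s₁ t₁) (h₂ : Exec c s s₂ t₂) : s₁ = s₂ ∧ t₁ = t₂ := by
  induction h₁ generalizing s₂ t₂ with
  | skip => cases h₂; exact ⟨rfl, rfl⟩
  | assign => cases h₂; exact ⟨rfl, rfl⟩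
  | write => cases h₂; exact ⟨rfl, rfl⟩
  | seq _ _ ih₁ ih₂ =>
    cases h₂ with
    | seq a b =>
      obtain ⟨rfl, rfl⟩ := ih₁ a
      obtain ⟨rfl, rfl⟩ := ih₂ b
      exact ⟨rfl, rfl⟩
  | ite_pos h _ ih =>
    cases h₂ with
    | ite_pos _ a => obtain ⟨rfl, rfl⟩ := ih a; exact ⟨rfl, rfl⟩
    | ite_neg h' _ => exact absurd h (not_lt.2 h')
  | ite_neg h _ ih =>
    cases h₂ with
    | ite_pos h' _ => exact absurd h' (not_lt.2 h)
    | ite_neg _ a => obtain ⟨rfl, rfl⟩ := ih a; exact ⟨rfl, rfl⟩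
  | loop_stop h =>
    cases h₂ with
    | loop_stop _ => exact ⟨rfl, rfl⟩
    | loop_step h' _ _ => exact absurd h' (not_lt.2 h)
  | loop_step h _ _ ih₁ ih₂ =>
    cases h₂ with
    | loop_stop h' => exact absurd h (not_lt.2 h')
    | loop_step _ a b =>
      obtain ⟨rfl, rfl⟩ := ih₁ a
      obtain ⟨rfl, rfl⟩ := ih₂ b
      exact ⟨rfl, rfl⟩

/-- An input of the machine: a list of integers and a list of integer arrays. -/
structure Input where
  scalars : List ℤ
  arrays : List (List ℤ)

/-- The encoding size of an input: the total bit length of all its entries. -/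
def Input.size (w : Input) : ℕ :=
  (w.scalars.map bitLen).sum + (w.arrays.map fun l => (l.map bitLen).sum).sum

/-- The initial memory: the scalars are in the registers `0, 1, …`, the arrays of the input are
`arr 1, arr 2, …` (indexed from `0`), and everything else is `0`. -/
def Input.initial (w : Input) : State where
  reg v := w.scalars.getD v 0
  arr a i := if 1 ≤ a ∧ 0 ≤ i then (w.arrays.getD (a - 1) []).getD i.toNat 0 else 0

/-- The output of a computation that computes a subset of `{0, …, m - 1}`: it is given by its
characteristic vector in array `0`. -/
def State.outputSet (s : State) (m : ℕ) : Finset (Fin m) :=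
  Finset.univ.filter fun j => s.arr 0 (j : ℕ) ≠ 0

/-- Some program halts on every input `a` with an output, a subset of `{0, …, m a - 1}`, that
satisfies `P a`, and its running time is bounded by a fixed polynomial in the encoding size. -/
def PolyTimeComputesSet {α : Type} (enc : α → Input) (m : α → ℕ)
    (P : (a : α) → Finset (Fin (m a)) → Prop) : Prop :=
  ∃ (c : Program) (p : Polynomial ℕ), ∀ a : α, ∃ (s : State) (t : ℕ),
    Exec c (enc a).initial s t ∧ t ≤ p.eval (enc a).size ∧ P a (s.outputSet (m a))

/-- A list of rationals, as the arrays of its numerators and of its denominators. -/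
def ratArrays (l : List ℚ) : List (List ℤ) :=
  [l.map fun q => q.num, l.map fun q => (q.den : ℤ)]

/-- The characteristic vector of a subset of `{0, …, m - 1}`. -/
def setArray {m : ℕ} (S : Finset (Fin m)) : List ℤ :=
  List.ofFn fun j => if j ∈ S then 1 else 0

end RAM

/-! ### Facility location -/

/-- The metric space `F ∪ C` of facilities and clients of a facility-location instance.
Distinct points may be co-located, that is, have distance `0`. -/
structure FLSpace where
  /-- the number of facilities -/
  nF : ℕ
  /-- the number of clients -/
  nC : ℕ
  nF_pos : 0 < nF
  dist : Fin nF ⊕ Fin nC → Fin nF ⊕ Fin nC → ℚ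
  dist_self : ∀ a, dist a a = 0
  dist_comm : ∀ a b, dist a b = dist b a
  dist_triangle : ∀ a b c, dist a c ≤ dist a b + dist b c

namespace FLSpace

variable (I : FLSpace)

/-- The distance between a facility and a client. -/
def dFC (i : Fin I.nF) (j : Fin I.nC) : ℝ := (I.dist (.inl i) (.inr j) : ℝ)

/-- The distance between two clients. -/
def dCC (j j' : Fin I.nC) : ℝ := (I.dist (.inr j) (.inr j') : ℝ)

/-- `(z, w)` is a fractional second-stage solution for the client set `A`, when the facilities are
already open to the extent `x`: `z i` is the extent to which facility `i` is opened, and `w i j`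
is the fraction of client `j` that is assigned to facility `i`. -/
structure IsFracSol (x : Fin I.nF → ℝ) (A : Finset (Fin I.nC))
    (z : Fin I.nF → ℝ) (w : Fin I.nF → Fin I.nC → ℝ) : Prop where
  z_nonneg : ∀ i, 0 ≤ z i
  w_nonneg : ∀ i j, 0 ≤ w i j
  assigned : ∀ j ∈ A, 1 ≤ ∑ i, w i j
  open_le : ∀ i, ∀ j ∈ A, w i j ≤ x i + z i

/-- The optimal cost of a fractional second-stage solution for the client set `A`, given the
first-stage decisions `x`, when opening facility `i` costs `f i`. -/
noncomputable def fracCost (f : Fin I.nF → ℚ) (x : Fin I.nF → ℝ) (A : Finset (Fin I.nC)) : ℝ :=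
  sInf {v | ∃ z w, I.IsFracSol x A z w ∧
    v = ∑ i, (f i : ℝ) * z i + ∑ j ∈ A, ∑ i, I.dFC i j * w i j}

/-- The optimal cost of an integral solution for the client set `A`: open a set `T` of facilities
and assign every client of `A` to one of them. -/
noncomputable def intCost (f : Fin I.nF → ℚ) (A : Finset (Fin I.nC)) : ℝ :=
  sInf {v | ∃ (T : Finset (Fin I.nF)) (φ : Fin I.nC → Fin I.nF), (∀ j ∈ A, φ j ∈ T) ∧
    v = ∑ i ∈ T, (f i : ℝ) + ∑ j ∈ A, I.dFC (φ j) j}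

/-- The list of the pairwise distances of the points of `F ∪ C`, row by row. -/
def distList : List ℚ :=
  List.ofFn fun p : Fin ((I.nF + I.nC) * (I.nF + I.nC)) =>
    I.dist (finSumFinEquiv.symm (finProdFinEquiv.symm p).1)
      (finSumFinEquiv.symm (finProdFinEquiv.symm p).2)

end FLSpace

/-! ### The function `g(x, y, A)` for distributionally robust 2-stage facility location -/

/-- An instance of 2-stage facility location: first- and second-stage opening costs. -/
structure TwoStageFL extends FLSpace where
  f₁ : Fin nF → ℚ
  f₂ : Fin nF → ℚ
  f₁_nonneg : ∀ i, 0 ≤ f₁ i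
  f₂_nonneg : ∀ i, 0 ≤ f₂ i

/-- The optimal fractional second-stage cost `g(x, A)` of scenario `A`. -/
noncomputable def TwoStageFL.g (I : TwoStageFL) (x : Fin I.nF → ℝ) (A : Finset (Fin I.nC)) : ℝ :=
  I.fracCost I.f₂ x A

/-- The two scenario metrics: the discrete metric and the asymmetric metric `σ^asym_∞`. -/
inductive ScenarioMetric where
  | discrete
  | asymInfty

/-- The distance from scenario `A` to scenario `A'`: it is `0` or `1` for the discrete metric, and
`max_{j' ∈ A'} min_{j ∈ A} dist j' j` for the asymmetric metric (a minimum over the empty set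
is `∞`, a maximum over the empty set is `0`). -/
noncomputable def FLSpace.scm (I : FLSpace) : ScenarioMetric →
    Finset (Fin I.nC) → Finset (Fin I.nC) → ℝ≥0∞
  | .discrete, A, A' => if A = A' then 0 else 1
  | .asymInfty, A, A' => ⨆ j' ∈ A', ⨅ j ∈ A, ENNReal.ofReal (I.dCC j' j)

/-- An input `(x, y, A)` for the problem `g(x, y, A)` in the `k`-bounded setting. The integral
first-stage decision `x` is given by the set of facilities that it opens. -/
structure GxyInput extends TwoStageFL where
  k : ℕ
  opened : Finset (Fin nF)
  y : ℚ
  y_nonneg : 0 ≤ y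
  A : Finset (Fin nC)
  card_A : A.card ≤ k

namespace GxyInput

/-- The first-stage decision, as a `0`-`1` vector. -/
def x (N : GxyInput) : Fin N.nF → ℝ := fun i => if i ∈ N.opened then 1 else 0

/-- `B` is an output allowed for a `(β₁, β₂)`-approximation algorithm for `g(x, y, A)`: it is a
scenario and `g(x, B) - y σ(A, B) ≥ g(x, A') / β₁ - β₂ y σ(A, A')` for all scenarios `A'`. -/
def IsApprox (N : GxyInput) (σ : ScenarioMetric) (β₁ β₂ : ℝ) (B : Finset (Fin N.nC)) : Prop :=
  B.card ≤ N.k ∧ ∀ A' : Finset (Fin N.nC), A'.card ≤ N.k →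
    ((N.g N.x A' / β₁ : ℝ) : EReal) - ((β₂ * N.y : ℝ) : EReal) * (N.scm σ N.A A' : EReal) ≤
      ((N.g N.x B : ℝ) : EReal) - ((N.y : ℝ) : EReal) * (N.scm σ N.A B : EReal)

/-- The encoding of an input. -/
def encode (N : GxyInput) : RAM.Input where
  scalars := [(N.nF : ℤ), (N.nC : ℤ), (N.k : ℤ), N.y.num, (N.y.den : ℤ)]
  arrays := RAM.ratArrays N.distList ++ RAM.ratArrays (List.ofFn N.f₁) ++
    RAM.ratArrays (List.ofFn N.f₂) ++ [RAM.setArray N.opened, RAM.setArray N.A]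

end GxyInput

/-! ### `k`-max-min facility location -/

/-- An instance of `k`-max-min facility location. -/
structure KMaxMinFL extends FLSpace where
  f : Fin nF → ℚ
  f_nonneg : ∀ i, 0 ≤ f i
  k : ℕ

namespace KMaxMinFL

variable (I : KMaxMinFL)

/-- `S` is a `β`-approximate solution to `max_{|A| ≤ k} cost A`. -/
def IsApprox (cost : Finset (Fin I.nC) → ℝ) (β : ℝ) (S : Finset (Fin I.nC)) : Prop :=
  S.card ≤ I.k ∧ ∀ A : Finset (Fin I.nC), A.card ≤ I.k → cost A / β ≤ cost S

/-- The time at which facility `i` is paid for by the client set `J ≠ ∅`, if every client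
contributes to it at unit rate from the time on when it has been reached. -/
noncomputable def payTime (J : Finset (Fin I.nC)) (i : Fin I.nF) : ℝ :=
  sInf {t : ℝ | 0 ≤ t ∧ (I.f i : ℝ) ≤ ∑ j ∈ J, max 0 (t - I.dFC i j)}

/-- The Pál–Tardos cost share of client `j` in the client set `J`. -/
noncomputable def costShare (J : Finset (Fin I.nC)) (j : Fin I.nC) : ℝ :=
  if j ∈ J then ⨅ i, max (I.payTime J i) (I.dFC i j) else 0

/-- `I.Greedy t J`: the client set `J` can be obtained by `t` steps of the greedy algorithm, which
starts from the empty set and in each step adds to the current set a client that then has the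
largest cost share. -/
inductive Greedy : ℕ → Finset (Fin I.nC) → Prop where
  | zero : Greedy 0 ∅
  | step {t : ℕ} {J : Finset (Fin I.nC)} {j : Fin I.nC} : Greedy t J → j ∉ J →
      (∀ j' ∉ J, I.costShare (insert j' J) j' ≤ I.costShare (insert j J) j) →
      Greedy (t + 1) (insert j J)

/-- `S` is a possible output of the greedy algorithm. -/
def IsGreedyOutput (S : Finset (Fin I.nC)) : Prop := I.Greedy (min I.k I.nC) S

/-- The encoding of an instance. -/
def encode : RAM.Input where
  scalars := [(I.nF : ℤ), (I.nC : ℤ), (I.k : ℤ)]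
  arrays := RAM.ratArrays I.distList ++ RAM.ratArrays (List.ofFn I.f)

end KMaxMinFL

/-!
The approximation guarantees rest on the Pál–Tardos cost shares. The shares of the clients in a set
`J` are a feasible solution of the dual of the linear program for the fractional cost of `J`
(`FLSpace.sum_le_fracCost`, `KMaxMinFL.sum_costShare_feasible`), they recover a third of the cost
of an integral solution (`KMaxMinFL.intCost_le_three_mul`), and they do not increase when other
clients join (`KMaxMinFL.costShare_anti`). Let `J` be the output of the greedy algorithm on a ground
set `D`, and let `τ` be the largest share of a client in `D \ J` that joins `J`, or `0` if
`J = D`. By cross-monotonicity, a set of at most `k` clients in `D` costs at most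
`3 * (∑ j ∈ J, costShare J j + k * τ)` (`KMaxMinFL.intCost_le_of_share_le`). On the other hand,
giving budget `τ` to all clients of `J` is dual feasible as well (`KMaxMinFL.GreedyOn.paid_le`), so
that the fractional cost of `J` is at least the average of the total share and `k * τ`
(`KMaxMinFL.GreedyOn.le_two_mul_fracCost`). Together, this gives the factor `6`.

For `g(x, y, A)`, the facilities opened in the first stage become free. For each of the at most
`nC + 1` candidate radii `r`, the greedy algorithm is run on the clients within radius `r` of `A`.
The quantity `(∑ j ∈ J, costShare J j + k * τ) / 2 - y * r` is a lower bound for the value of its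
output; the algorithm returns the output for which it is largest (`GxyInput.output_spec`).
No linear program has to be solved.

For the running times, a calculus of polynomial-time functions is set up for the random access
machine (`RAM.Comp`): a function is in the calculus if some program computes it into a fresh
register, in polynomial time and with results of polynomial bit length. The calculus is closed
under arithmetic, case distinctions, substitution (`RAM.Comp.call`) and loops whose accumulator
stays polynomially long (`RAM.Comp.iter`). Both algorithms are written as functions of the input
in it, with sets of clients encoded as bit vectors in a single integer. All numbers are first
multiplied by the product of all denominators and by `nC !`. Since the time at which a facility is
paid for may be replaced by a minimum of averages over at most `nC` clients
(`KMaxMinFL.max_avgTime_eq`), all cost shares are then integers, and the machine computes them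
exactly (`RAM.GreedyData.Represents.share_eq`).
-/

/-! ### Bounds for the fractional and the integral cost -/

namespace FLSpace

variable (I : FLSpace)

theorem dist_nonneg (a b : Fin I.nF ⊕ Fin I.nC) : 0 ≤ I.dist a b := by
  have h := I.dist_triangle a b a
  rw [I.dist_self, I.dist_comm b a] at h
  linarith

theorem dFC_nonneg (i : Fin I.nF) (j : Fin I.nC) : 0 ≤ I.dFC i j := by
  unfold dFC; exact_mod_cast I.dist_nonneg _ _

theorem dCC_nonneg (j j' : Fin I.nC) : 0 ≤ I.dCC j j' := by
  unfold dCC; exact_mod_cast I.dist_nonneg _ _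

/-- Weak duality: budgets `v j` that do not overpay any facility are a lower bound for the
fractional cost. The costs `f'` vanish on the facilities that `x` opens for free. -/
theorem sum_le_fracCost {f f' : Fin I.nF → ℚ} {x : Fin I.nF → ℝ} {J : Finset (Fin I.nC)}
    {v : Fin I.nC → ℝ} (hx : ∀ i, 0 ≤ x i) (hfx : ∀ i, (f' i : ℝ) * x i = 0)
    (hff : ∀ i, f' i ≤ f i) (hv : ∀ j ∈ J, 0 ≤ v j)
    (hfeas : ∀ i, ∑ j ∈ J, max 0 (v j - I.dFC i j) ≤ f' i) :
    ∑ j ∈ J, v j ≤ I.fracCost f x J := by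
  refine le_csInf ⟨_, fun _ => 1, fun _ _ => 1, ⟨fun _ => zero_le_one, fun _ _ => zero_le_one,
    fun j _ => ?_, fun i j _ => by linarith [hx i]⟩, rfl⟩ ?_
  · have : (1 : ℝ) ≤ I.nF := by exact_mod_cast I.nF_pos
    simpa using this
  rintro _ ⟨z, w, h, rfl⟩
  have key : ∀ j ∈ J, v j ≤ ∑ i, (I.dFC i j * w i j + max 0 (v j - I.dFC i j) * (x i + z i)) := by
    intro j hj
    calc v j ≤ v j * ∑ i, w i j := le_mul_of_one_le_right (hv j hj) (h.assigned j hj)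
      _ = ∑ i, (I.dFC i j * w i j + (v j - I.dFC i j) * w i j) := by
        rw [Finset.mul_sum]; exact Finset.sum_congr rfl fun i _ => by ring
      _ ≤ _ := by
        gcongr with i
        · exact h.w_nonneg i j
        · exact le_max_right _ _
        · exact h.open_le i j hj
  calc ∑ j ∈ J, v j
      ≤ ∑ j ∈ J, ∑ i, (I.dFC i j * w i j + max 0 (v j - I.dFC i j) * (x i + z i)) :=
        Finset.sum_le_sum key
    _ = ∑ i, (∑ j ∈ J, max 0 (v j - I.dFC i j)) * (x i + z i)
          + ∑ j ∈ J, ∑ i, I.dFC i j * w i j := by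
        simp_rw [Finset.sum_add_distrib, Finset.sum_mul]
        rw [add_comm, Finset.sum_comm (s := J) (t := Finset.univ)
          (f := fun j i => max 0 (v j - I.dFC i j) * (x i + z i))]
    _ ≤ _ := by
        refine add_le_add_left (Finset.sum_le_sum fun i _ => ?_) _
        calc (∑ j ∈ J, max 0 (v j - I.dFC i j)) * (x i + z i) ≤ f' i * (x i + z i) := by
              gcongr
              · linarith [hx i, h.z_nonneg i]
              · exact hfeas i
          _ = f' i * z i := by rw [mul_add, hfx, zero_add]
          _ ≤ f i * z i := by
              gcongr
              · exact h.z_nonneg i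
              · exact_mod_cast hff i

theorem fracCost_nonneg {f : Fin I.nF → ℚ} {x : Fin I.nF → ℝ} (hf : ∀ i, 0 ≤ f i)
    (J : Finset (Fin I.nC)) : 0 ≤ I.fracCost f x J := by
  refine Real.sInf_nonneg ?_
  rintro _ ⟨z, w, h, rfl⟩
  have hf' : ∀ i, (0 : ℝ) ≤ f i := fun i => by exact_mod_cast hf i
  exact add_nonneg (Finset.sum_nonneg fun i _ => mul_nonneg (hf' i) (h.z_nonneg i))
    (Finset.sum_nonneg fun j _ => Finset.sum_nonneg fun i _ =>
      mul_nonneg (I.dFC_nonneg i j) (h.w_nonneg i j))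

theorem intCost_le {f : Fin I.nF → ℚ} (hf : ∀ i, 0 ≤ f i) {J : Finset (Fin I.nC)}
    (T : Finset (Fin I.nF)) (φ : Fin I.nC → Fin I.nF) (h : ∀ j ∈ J, φ j ∈ T) :
    I.intCost f J ≤ ∑ i ∈ T, (f i : ℝ) + ∑ j ∈ J, I.dFC (φ j) j := by
  refine csInf_le ⟨0, ?_⟩ ⟨T, φ, h, rfl⟩
  rintro _ ⟨T, φ, -, rfl⟩
  exact add_nonneg (Finset.sum_nonneg fun i _ => by exact_mod_cast hf i)
    (Finset.sum_nonneg fun j _ => I.dFC_nonneg _ _)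

theorem intCost_set_nonempty (f : Fin I.nF → ℚ) (J : Finset (Fin I.nC)) :
    {v | ∃ (T : Finset (Fin I.nF)) (φ : Fin I.nC → Fin I.nF), (∀ j ∈ J, φ j ∈ T) ∧
      v = ∑ i ∈ T, (f i : ℝ) + ∑ j ∈ J, I.dFC (φ j) j}.Nonempty :=
  ⟨_, Finset.univ, fun _ => ⟨0, I.nF_pos⟩, fun _ _ => Finset.mem_univ _, rfl⟩

theorem intCost_mono {f : Fin I.nF → ℚ} (hf : ∀ i, 0 ≤ f i) {J J' : Finset (Fin I.nC)}
    (h : J ⊆ J') : I.intCost f J ≤ I.intCost f J' := by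
  refine le_csInf (I.intCost_set_nonempty f J') ?_
  rintro _ ⟨T, φ, hφ, rfl⟩
  refine (I.intCost_le hf T φ fun j hj => hφ j (h hj)).trans ?_
  gcongr
  exact fun _ _ _ => I.dFC_nonneg _ _

theorem fracCost_le_intCost {f f' : Fin I.nF → ℚ} {x : Fin I.nF → ℝ} (hx : ∀ i, 0 ≤ x i)
    (hf : ∀ i, 0 ≤ f i) (hf' : ∀ i, 0 ≤ f' i) (hfx : ∀ i, f' i = f i ∨ 1 ≤ x i)
    (J : Finset (Fin I.nC)) : I.fracCost f x J ≤ I.intCost f' J := by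
  classical
  refine le_csInf (I.intCost_set_nonempty f' J) ?_
  rintro _ ⟨T, φ, hφ, rfl⟩
  set z : Fin I.nF → ℝ := fun i => if i ∈ T ∧ x i < 1 then 1 else 0 with hz
  set w : Fin I.nF → Fin I.nC → ℝ := fun i j => if φ j = i then 1 else 0 with hw
  have hsol : I.IsFracSol x J z w := by
    refine ⟨fun i => ?_, fun i j => ?_, fun j _ => ?_, fun i j hj => ?_⟩
    · simp only [hz]; split_ifs <;> norm_num
    · simp only [hw]; split_ifs <;> norm_num
    · simp [hw]
    · simp only [hw, hz]
      have := hx i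
      by_cases h1 : φ j = i
      · have : i ∈ T := h1 ▸ hφ j hj
        by_cases h2 : x i < 1
        · simp [h1, this, h2, hx i]
        · simp [h1, h2, not_lt.1 h2]
      · rw [if_neg h1]; split_ifs <;> linarith
  have hbdd : BddBelow {v | ∃ z w, I.IsFracSol x J z w ∧
      v = ∑ i, (f i : ℝ) * z i + ∑ j ∈ J, ∑ i, I.dFC i j * w i j} := by
    refine ⟨0, ?_⟩
    rintro _ ⟨z, w, h, rfl⟩
    exact add_nonneg
      (Finset.sum_nonneg fun i _ => mul_nonneg (by exact_mod_cast hf i) (h.z_nonneg i))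
      (Finset.sum_nonneg fun j _ => Finset.sum_nonneg fun i _ =>
        mul_nonneg (I.dFC_nonneg i j) (h.w_nonneg i j))
  refine (csInf_le hbdd ⟨z, w, hsol, rfl⟩).trans (add_le_add ?_ (le_of_eq ?_))
  · rw [← Finset.sum_subset (Finset.subset_univ T) fun i _ hi => by simp [hz, hi]]
    refine Finset.sum_le_sum fun i hi => ?_
    have h0 : (0 : ℝ) ≤ f' i := by exact_mod_cast hf' i
    rcases hfx i with h | h
    · simp only [hz, ← h]; split_ifs <;> simp [h0]
    · simp [hz, not_lt.2 h, h0]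
  · exact Finset.sum_congr rfl fun j _ => by simp [hw]

end FLSpace

/-! ### Pál–Tardos cost shares -/

namespace KMaxMinFL

variable (I : KMaxMinFL)

/-- The amount that the clients in `J` have contributed to facility `i` at time `t`. -/
noncomputable def paid (J : Finset (Fin I.nC)) (i : Fin I.nF) (t : ℝ) : ℝ :=
  ∑ j ∈ J, max 0 (t - I.dFC i j)

theorem paid_mono_time (J : Finset (Fin I.nC)) (i : Fin I.nF) {s t : ℝ} (h : s ≤ t) :
    I.paid J i s ≤ I.paid J i t := by
  unfold paid; gcongr

theorem paid_mono {J J' : Finset (Fin I.nC)} (h : J ⊆ J') (i : Fin I.nF) (t : ℝ) :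
    I.paid J i t ≤ I.paid J' i t :=
  Finset.sum_le_sum_of_subset_of_nonneg h fun _ _ _ => le_max_left _ _

theorem bddBelow_payTimes (J : Finset (Fin I.nC)) (i : Fin I.nF) :
    BddBelow {t : ℝ | 0 ≤ t ∧ (I.f i : ℝ) ≤ I.paid J i t} := ⟨0, fun _ h => h.1⟩

theorem payTimes_nonempty {J : Finset (Fin I.nC)} (hJ : J.Nonempty) (i : Fin I.nF) :
    {t : ℝ | 0 ≤ t ∧ (I.f i : ℝ) ≤ I.paid J i t}.Nonempty := by
  obtain ⟨j, hj⟩ := hJ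
  have hf : (0 : ℝ) ≤ I.f i := by exact_mod_cast I.f_nonneg i
  refine ⟨I.f i + I.dFC i j, add_nonneg hf (I.dFC_nonneg i j), ?_⟩
  refine le_trans ?_ (Finset.single_le_sum (f := fun j' => max 0 (I.f i + I.dFC i j - I.dFC i j'))
    (fun _ _ => le_max_left _ _) hj)
  simp

theorem payTime_nonneg (J : Finset (Fin I.nC)) (i : Fin I.nF) : 0 ≤ I.payTime J i :=
  Real.sInf_nonneg fun _ h => h.1

theorem payTime_le {J : Finset (Fin I.nC)} {i : Fin I.nF} {t : ℝ} (ht : 0 ≤ t)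
    (h : (I.f i : ℝ) ≤ I.paid J i t) : I.payTime J i ≤ t :=
  csInf_le (I.bddBelow_payTimes J i) ⟨ht, h⟩

theorem le_paid_payTime {J : Finset (Fin I.nC)} (hJ : J.Nonempty) (i : Fin I.nF) :
    (I.f i : ℝ) ≤ I.paid J i (I.payTime J i) := by
  have hc : Continuous (I.paid J i) := by unfold paid; fun_prop
  have hclosed : IsClosed {t : ℝ | 0 ≤ t ∧ (I.f i : ℝ) ≤ I.paid J i t} :=
    (isClosed_le continuous_const continuous_id).inter (isClosed_le continuous_const hc)
  exact (hclosed.csInf_mem (I.payTimes_nonempty hJ i) (I.bddBelow_payTimes J i)).2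

/-- A facility that is overpaid at time `t` has been paid for strictly before `t`. -/
theorem payTime_lt {J : Finset (Fin I.nC)} {i : Fin I.nF} {t : ℝ}
    (h : (I.f i : ℝ) < I.paid J i t) : I.payTime J i < t := by
  have hf : (0 : ℝ) ≤ I.f i := by exact_mod_cast I.f_nonneg i
  have hpos : 0 < I.paid J i t := hf.trans_lt h
  obtain ⟨j, hj, hjt⟩ : ∃ j ∈ J, 0 < max 0 (t - I.dFC i j) := by
    by_contra! hc
    exact absurd hpos (not_lt.2 (Finset.sum_nonpos hc))
  have ht : 0 < t := by
    rcases lt_max_iff.1 hjt with h' | h'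
    · exact absurd h' (lt_irrefl _)
    · linarith [I.dFC_nonneg i j]
  have hc : (0 : ℝ) < J.card := by exact_mod_cast Finset.card_pos.2 ⟨j, hj⟩
  -- going back in time by `ε` loses at most `J.card * ε`
  set ε := min t ((I.paid J i t - I.f i) / J.card) with hε
  have hε0 : 0 < ε := lt_min ht (div_pos (sub_pos.2 h) hc)
  have hε1 : J.card * ε ≤ I.paid J i t - I.f i := by
    have := min_le_right t ((I.paid J i t - I.f i) / J.card)
    rw [← hε, le_div_iff₀ hc] at this
    linarith
  have hloss : I.paid J i t ≤ I.paid J i (t - ε) + J.card * ε := by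
    unfold paid
    rw [← nsmul_eq_mul, ← Finset.sum_const, ← Finset.sum_add_distrib]
    refine Finset.sum_le_sum fun j _ => max_le (add_nonneg (le_max_left _ _) hε0.le) ?_
    linarith [le_max_right 0 (t - ε - I.dFC i j)]
  refine (I.payTime_le (sub_nonneg.2 (min_le_left _ _)) ?_).trans_lt (sub_lt_self t hε0)
  linarith

theorem paid_payTime_le (J : Finset (Fin I.nC)) (i : Fin I.nF) :
    I.paid J i (I.payTime J i) ≤ I.f i := by
  by_contra! h
  exact lt_irrefl _ (I.payTime_lt h)

theorem payTime_anti {J J' : Finset (Fin I.nC)} (hJ : J.Nonempty) (h : J ⊆ J') (i : Fin I.nF) :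
    I.payTime J' i ≤ I.payTime J i :=
  I.payTime_le (I.payTime_nonneg J i) ((I.le_paid_payTime hJ i).trans (I.paid_mono h i _))

theorem costShare_le {J : Finset (Fin I.nC)} {j : Fin I.nC} (hj : j ∈ J) (i : Fin I.nF) :
    I.costShare J j ≤ max (I.payTime J i) (I.dFC i j) := by
  rw [costShare, if_pos hj]
  exact ciInf_le (Set.finite_range _).bddBelow i

theorem exists_costShare_eq {J : Finset (Fin I.nC)} {j : Fin I.nC} (hj : j ∈ J) :
    ∃ i, I.costShare J j = max (I.payTime J i) (I.dFC i j) := by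
  have : Nonempty (Fin I.nF) := ⟨⟨0, I.nF_pos⟩⟩
  obtain ⟨i, hi⟩ := exists_eq_ciInf_of_finite (f := fun i => max (I.payTime J i) (I.dFC i j))
  exact ⟨i, by rw [costShare, if_pos hj, hi]⟩

theorem costShare_nonneg (J : Finset (Fin I.nC)) (j : Fin I.nC) : 0 ≤ I.costShare J j := by
  by_cases hj : j ∈ J
  · obtain ⟨i, hi⟩ := I.exists_costShare_eq hj
    exact hi ▸ (I.payTime_nonneg J i).trans (le_max_left _ _)
  · rw [costShare, if_neg hj]

/-- Cross-monotonicity: the share of a client does not increase when other clients join. -/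
theorem costShare_anti {J J' : Finset (Fin I.nC)} (h : J ⊆ J') {j : Fin I.nC} (hj : j ∈ J) :
    I.costShare J' j ≤ I.costShare J j := by
  obtain ⟨i, hi⟩ := I.exists_costShare_eq hj
  rw [hi]
  exact (I.costShare_le (h hj) i).trans (max_le_max (I.payTime_anti ⟨j, hj⟩ h i) le_rfl)

/-- The cost shares are a feasible solution of the dual linear program. -/
theorem sum_costShare_feasible (J : Finset (Fin I.nC)) (i : Fin I.nF) :
    ∑ j ∈ J, max 0 (I.costShare J j - I.dFC i j) ≤ I.f i := by
  refine le_trans (Finset.sum_le_sum fun j hj => ?_) (I.paid_payTime_le J i)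
  refine max_le (le_max_left _ _) ?_
  rcases le_max_iff.1 (I.costShare_le hj i) with h | h
  · exact (sub_le_sub_right h _).trans (le_max_right _ _)
  · exact (sub_nonpos.2 h).trans (le_max_left _ _)

/-- A maximal well-separated set of facilities, chosen in the order of the times `t`. -/
theorem exists_separated (t : Fin I.nF → ℝ) (U : Finset (Fin I.nF)) :
    ∃ T ⊆ U, (∀ i ∈ T, ∀ i' ∈ T, i ≠ i' → 2 * t i < (I.dist (.inl i) (.inl i') : ℝ)) ∧
      ∀ i ∈ U, ∃ i' ∈ T, t i' ≤ t i ∧ (I.dist (.inl i) (.inl i') : ℝ) ≤ max 0 (2 * t i) := by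
  classical
  induction U using Finset.induction_on_max_value t with
  | empty => exact ⟨∅, subset_rfl, by simp, by simp⟩
  | insert a U haU hmax ih =>
    obtain ⟨T, hTU, hsep, hcov⟩ := ih
    by_cases ha : ∃ i' ∈ T, (I.dist (.inl a) (.inl i') : ℝ) ≤ 2 * t a
    · obtain ⟨i', hi', hd⟩ := ha
      refine ⟨T, hTU.trans (Finset.subset_insert _ _), hsep, fun i hi => ?_⟩
      rcases Finset.mem_insert.1 hi with rfl | hi
      · exact ⟨i', hi', hmax i' (hTU hi'), hd.trans (le_max_right _ _)⟩
      · exact hcov i hi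
    · push Not at ha
      refine ⟨insert a T, Finset.insert_subset_insert _ hTU, ?_, fun i hi => ?_⟩
      · intro i hi i' hi' hne
        rcases Finset.mem_insert.1 hi with h | h <;> rcases Finset.mem_insert.1 hi' with h' | h'
        · exact absurd (h.trans h'.symm) hne
        · exact h ▸ ha i' h'
        · rw [I.dist_comm, h']
          linarith [ha i h, hmax i (hTU h)]
        · exact hsep i h i' h' hne
      · rcases Finset.mem_insert.1 hi with rfl | hi
        · exact ⟨i, Finset.mem_insert_self _ _, le_rfl, by simp [I.dist_self]⟩
        · obtain ⟨i', hi', h⟩ := hcov i hi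
          exact ⟨i', Finset.mem_insert_of_mem hi', h⟩

/-- The Pál–Tardos cost shares recover a third of the cost of an integral solution: opening a
well-separated set of facilities and assigning every client to the facility that it helps to pay
for, if there is one, and otherwise to an open facility near the one that determines its share,
costs at most three times the share of each client. -/
theorem intCost_le_three_mul (J : Finset (Fin I.nC)) :
    I.intCost I.f J ≤ 3 * ∑ j ∈ J, I.costShare J j := by
  classical
  rcases J.eq_empty_or_nonempty with rfl | hJ
  · have := I.intCost_le I.f_nonneg (J := ∅) ∅ (fun _ => ⟨0, I.nF_pos⟩) (by simp)
    simpa using this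
  set t := I.payTime J with ht
  have ht0 : ∀ i, 0 ≤ t i := I.payTime_nonneg J
  obtain ⟨T, -, hsep, hcov⟩ := I.exists_separated t Finset.univ
  have hFC : ∀ i i' j, (I.dist (.inl i) (.inl i') : ℝ) ≤ I.dFC i j + I.dFC i' j := by
    intro i i' j
    have := I.dist_triangle (.inl i) (.inr j) (.inl i')
    rw [I.dist_comm (.inr j)] at this
    unfold FLSpace.dFC
    exact_mod_cast this
  have hFF : ∀ i i' j, I.dFC i' j ≤ (I.dist (.inl i) (.inl i') : ℝ) + I.dFC i j := by
    intro i i' j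
    have := I.dist_triangle (.inl i') (.inl i) (.inr j)
    rw [I.dist_comm (.inl i') (.inl i)] at this
    unfold FLSpace.dFC
    exact_mod_cast this
  -- every client has an open facility within three times its share
  have hnear : ∀ j ∈ J, ∃ i ∈ T, I.dFC i j ≤ 3 * I.costShare J j ∧ t i ≤ I.costShare J j := by
    intro j hj
    obtain ⟨i, hi⟩ := I.exists_costShare_eq hj
    obtain ⟨i', hi', hti, hd⟩ := hcov i (Finset.mem_univ _)
    rw [max_eq_right (by linarith [ht0 i])] at hd
    have h1 : t i ≤ I.costShare J j := hi ▸ le_max_left _ _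
    have h2 : I.dFC i j ≤ I.costShare J j := hi ▸ le_max_right _ _
    exact ⟨i', hi', by linarith [hFF i i' j], hti.trans h1⟩
  -- a client pays for at most one open facility, which opens at most at three times its share
  have hclose : ∀ j ∈ J, ∀ i ∈ T, I.dFC i j < t i → t i ≤ 3 * I.costShare J j := by
    intro j hj i hi hij
    obtain ⟨i', hi', hd, hti⟩ := hnear j hj
    by_cases hne : i = i'
    · subst hne; linarith [I.costShare_nonneg J j]
    · have := hsep i hi i' hi' hne
      linarith [hFC i i' j]
  have huniq : ∀ j, ∀ i ∈ T, ∀ i' ∈ T, I.dFC i j < t i → I.dFC i' j < t i' → i = i' := by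
    intro j i hi i' hi' h h'
    by_contra hne
    have h1 := hsep i hi i' hi' hne
    have h2 := hsep i' hi' i hi (Ne.symm hne)
    rw [I.dist_comm] at h2
    linarith [hFC i i' j]
  have hφ : ∀ j, ∃ i, j ∈ J → i ∈ T ∧
      ∑ i' ∈ T, max 0 (t i' - I.dFC i' j) + I.dFC i j ≤ 3 * I.costShare J j := by
    intro j
    by_cases hj : j ∈ J
    swap
    · exact ⟨⟨0, I.nF_pos⟩, fun h => absurd h hj⟩
    by_cases hex : ∃ i ∈ T, I.dFC i j < t i
    · obtain ⟨i, hi, hij⟩ := hex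
      refine ⟨i, fun _ => ⟨hi, ?_⟩⟩
      rw [Finset.sum_eq_single_of_mem i hi fun i' hi' hne => max_eq_left <| by
        by_contra! h
        exact hne (huniq j i' hi' i hi (by linarith) hij)]
      rw [max_eq_right (by linarith)]
      linarith [hclose j hj i hi hij]
    · push Not at hex
      obtain ⟨i, hi, hd, -⟩ := hnear j hj
      refine ⟨i, fun _ => ⟨hi, ?_⟩⟩
      rw [Finset.sum_eq_zero fun i' hi' => max_eq_left (by linarith [hex i' hi'])]
      linarith
  choose φ hφ using hφ
  refine (I.intCost_le I.f_nonneg T φ fun j hj => (hφ j hj).1).trans ?_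
  calc ∑ i ∈ T, (I.f i : ℝ) + ∑ j ∈ J, I.dFC (φ j) j
      ≤ ∑ i ∈ T, ∑ j ∈ J, max 0 (t i - I.dFC i j) + ∑ j ∈ J, I.dFC (φ j) j := by
        gcongr with i
        exact I.le_paid_payTime hJ i
    _ = ∑ j ∈ J, (∑ i ∈ T, max 0 (t i - I.dFC i j) + I.dFC (φ j) j) := by
        rw [Finset.sum_comm, Finset.sum_add_distrib]
    _ ≤ ∑ j ∈ J, 3 * I.costShare J j := Finset.sum_le_sum fun j hj => (hφ j hj).2
    _ = _ := by rw [Finset.mul_sum]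

/-! ### The greedy algorithm on a ground set of clients -/

/-- `I.GreedyOn D t J`: the set `J` can be obtained by `t` steps of the greedy algorithm that only
considers the clients in `D`. -/
inductive GreedyOn (D : Finset (Fin I.nC)) : ℕ → Finset (Fin I.nC) → Prop where
  | zero : GreedyOn D 0 ∅
  | step {t : ℕ} {J : Finset (Fin I.nC)} {j : Fin I.nC} : GreedyOn D t J → j ∈ D → j ∉ J →
      (∀ j' ∈ D, j' ∉ J → I.costShare (insert j' J) j' ≤ I.costShare (insert j J) j) →
      GreedyOn D (t + 1) (insert j J)

variable {I}

theorem greedyOn_univ_iff {t : ℕ} {J : Finset (Fin I.nC)} :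
    I.GreedyOn Finset.univ t J ↔ I.Greedy t J := by
  constructor
  · intro h
    induction h with
    | zero => exact .zero
    | step _ _ hj hmax ih => exact .step ih hj fun j' hj' => hmax j' (Finset.mem_univ _) hj'
  · intro h
    induction h with
    | zero => exact .zero
    | step _ hj hmax ih => exact .step ih (Finset.mem_univ _) hj fun j' _ hj' => hmax j' hj'

theorem GreedyOn.subset {D : Finset (Fin I.nC)} {t : ℕ} {J : Finset (Fin I.nC)}
    (h : I.GreedyOn D t J) : J ⊆ D := by
  induction h with
  | zero => simp
  | step _ hD _ _ ih => exact Finset.insert_subset hD ih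

theorem GreedyOn.card_eq {D : Finset (Fin I.nC)} {t : ℕ} {J : Finset (Fin I.nC)}
    (h : I.GreedyOn D t J) : J.card = t := by
  induction h with
  | zero => simp
  | step _ _ hj _ ih => rw [Finset.card_insert_of_notMem hj, ih]

/-- If the greedy algorithm could still add a client of share `τ`, then giving every chosen client
the budget `τ` is feasible for the dual: the last client that contributes to an overpaid facility
would have had a share below `τ` when it was chosen. -/
theorem GreedyOn.paid_le {D : Finset (Fin I.nC)} {t : ℕ} {J : Finset (Fin I.nC)}
    (h : I.GreedyOn D t J) {j₀ : Fin I.nC} (hD : j₀ ∈ D) (hJ : j₀ ∉ J) (i : Fin I.nF) :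
    I.paid J i (I.costShare (insert j₀ J) j₀) ≤ I.f i := by
  induction h with
  | zero => simpa [paid] using I.f_nonneg i
  | @step t J j _ _ hj hmax ih =>
    have hJ' : j₀ ∉ J := fun h => hJ (Finset.mem_insert_of_mem h)
    set τ := I.costShare (insert j₀ (insert j J)) j₀ with hτ
    have h1 : τ ≤ I.costShare (insert j₀ J) j₀ :=
      I.costShare_anti (Finset.insert_subset_insert _ (Finset.subset_insert _ _))
        (Finset.mem_insert_self _ _)
    have h2 : τ ≤ I.costShare (insert j J) j := h1.trans (hmax j₀ hD hJ')
    by_cases hij : τ ≤ I.dFC i j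
    · unfold paid
      rw [Finset.sum_insert hj, max_eq_left (sub_nonpos.2 hij), zero_add]
      exact (I.paid_mono_time J i h1).trans (ih hJ')
    · by_contra! hover
      have h3 := I.costShare_le (Finset.mem_insert_self j J) i
      exact absurd (h2.trans h3) (not_le.2 (max_lt (I.payTime_lt hover) (not_le.1 hij)))

variable (I)

/-- Among all sets of at most `k` clients of `D`, none costs more than three times the total share
of `J` plus `k` times the largest share `τ` of a client that joins `J`. -/
theorem intCost_le_of_share_le {D J A : Finset (Fin I.nC)} {k : ℕ} {τ : ℝ} (hτ0 : 0 ≤ τ)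
    (hτ : ∀ j ∈ D, j ∉ J → I.costShare (insert j J) j ≤ τ) (hA : A ⊆ D) (hk : A.card ≤ k) :
    I.intCost I.f A ≤ 3 * (∑ j ∈ J, I.costShare J j + k * τ) := by
  classical
  have h1 : ∑ j ∈ J ∪ A, I.costShare (J ∪ A) j ≤
      ∑ j ∈ J, I.costShare J j + ∑ j ∈ A \ J, τ := by
    rw [← Finset.union_sdiff_self_eq_union, Finset.sum_union Finset.disjoint_sdiff,
      Finset.union_sdiff_self_eq_union]
    gcongr with j hj j hj
    · exact I.costShare_anti Finset.subset_union_left hj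
    · obtain ⟨hjA, hjJ⟩ := Finset.mem_sdiff.1 hj
      refine (I.costShare_anti ?_ (Finset.mem_insert_self j J)).trans (hτ j (hA hjA) hjJ)
      exact Finset.insert_subset (Finset.mem_union_right _ hjA) Finset.subset_union_left
  have h2 : ∑ j ∈ A \ J, τ ≤ k * τ := by
    rw [Finset.sum_const, nsmul_eq_mul]
    gcongr
    exact_mod_cast (Finset.card_le_card Finset.sdiff_subset).trans hk
  linarith [I.intCost_mono I.f_nonneg (Finset.subset_union_right (s₁ := J) (s₂ := A)),
    I.intCost_le_three_mul (J ∪ A)]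

variable {I}

/-- The lower bound that matches `intCost_le_of_share_le`: it is the average of the dual solutions
given by the cost shares and by the budget `τ` for every client. -/
theorem GreedyOn.le_two_mul_fracCost {D J : Finset (Fin I.nC)} {t k : ℕ} {τ : ℝ}
    (h : I.GreedyOn D t J)
    (hτ : (τ = 0) ∨ (J.card = k ∧ ∃ j ∈ D, j ∉ J ∧ τ = I.costShare (insert j J) j))
    {f : Fin I.nF → ℚ} {x : Fin I.nF → ℝ} (hx : ∀ i, 0 ≤ x i) (hfx : ∀ i, (I.f i : ℝ) * x i = 0)
    (hff : ∀ i, I.f i ≤ f i) :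
    ∑ j ∈ J, I.costShare J j + k * τ ≤ 2 * I.fracCost f x J := by
  have h1 := I.sum_le_fracCost (J := J) hx hfx hff (fun j _ => I.costShare_nonneg J j)
    (I.sum_costShare_feasible J)
  rcases hτ with rfl | ⟨rfl, j, hD, hJ, rfl⟩
  · have h0 : 0 ≤ I.fracCost f x J :=
      (Finset.sum_nonneg fun j _ => I.costShare_nonneg J j).trans h1
    linarith
  · have h2 := I.sum_le_fracCost (J := J) (v := fun _ => I.costShare (insert j J) j) hx hfx hff
      (fun _ _ => I.costShare_nonneg _ _) (h.paid_le hD hJ)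
    rw [Finset.sum_const, nsmul_eq_mul] at h2
    linarith

end KMaxMinFL

namespace RAM

/-! ### Bit lengths -/

theorem bitLen_le_of_lt {z : ℤ} {n : ℕ} (h : z.natAbs < 2 ^ n) : bitLen z ≤ n + 1 :=
  Nat.succ_le_succ (Nat.size_le.2 h)

theorem one_le_bitLen (z : ℤ) : 1 ≤ bitLen z := Nat.le_add_left _ _

theorem bitLen_mono {a b : ℤ} (h : a.natAbs ≤ b.natAbs) : bitLen a ≤ bitLen b :=
  Nat.succ_le_succ (Nat.size_le_size h)

theorem bitLen_neg (a : ℤ) : bitLen (-a) = bitLen a := by simp [bitLen]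

theorem bitLen_le_natAbs (z : ℤ) : bitLen z ≤ z.natAbs + 1 := bitLen_le_of_lt Nat.lt_two_pow_self

theorem bitLen_add (a b : ℤ) : bitLen (a + b) ≤ bitLen a + bitLen b := by
  have ha := Nat.lt_size_self a.natAbs
  have hb := Nat.lt_size_self b.natAbs
  refine (bitLen_le_of_lt (n := a.natAbs.size + b.natAbs.size + 1) ?_).trans
    (by unfold bitLen; omega)
  have h1 : 2 ^ a.natAbs.size ≤ 2 ^ (a.natAbs.size + b.natAbs.size) :=
    Nat.pow_le_pow_right two_pos (Nat.le_add_right _ _)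
  have h2 : 2 ^ b.natAbs.size ≤ 2 ^ (a.natAbs.size + b.natAbs.size) :=
    Nat.pow_le_pow_right two_pos (Nat.le_add_left _ _)
  have := Int.natAbs_add_le a b
  rw [pow_succ]; omega

theorem bitLen_sub (a b : ℤ) : bitLen (a - b) ≤ bitLen a + bitLen b := by
  have := bitLen_add a (-b)
  rwa [bitLen_neg, ← sub_eq_add_neg] at this

theorem bitLen_mul (a b : ℤ) : bitLen (a * b) ≤ bitLen a + bitLen b := by
  refine (bitLen_le_of_lt (n := a.natAbs.size + b.natAbs.size) ?_).trans (by unfold bitLen; omega)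
  rw [Int.natAbs_mul, pow_add]
  exact Nat.mul_lt_mul'' (Nat.lt_size_self _) (Nat.lt_size_self _)

theorem bitLen_div (a b : ℤ) : bitLen (a / b) ≤ bitLen a :=
  bitLen_mono (Int.natAbs_ediv_le_natAbs a b)

/-! ### Running programs -/

/-- The program `c`, started with memory `s`, halts within time `T` with a memory that
satisfies `Q`. -/
def Runs (c : Program) (s : State) (T : ℕ) (Q : State → Prop) : Prop :=
  ∃ s' t, Exec c s s' t ∧ t ≤ T ∧ Q s'

theorem Runs.mono {c : Program} {s : State} {T T' : ℕ} {Q Q' : State → Prop} (h : Runs c s T Q)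
    (hT : T ≤ T') (hQ : ∀ s', Q s' → Q' s') : Runs c s T' Q' := by
  obtain ⟨s', t, h, ht, hs⟩ := h
  exact ⟨s', t, h, ht.trans hT, hQ s' hs⟩

theorem Runs.assign {s : State} {v : ℕ} {e : Expr} {Q : State → Prop}
    (h : Q (s.setReg v (e.eval s))) : Runs (.assign v e) s (e.cost s + 1) Q :=
  ⟨_, _, .assign s v e, le_rfl, h⟩

theorem Runs.write {s : State} {a : ℕ} {i e : Expr} {Q : State → Prop}
    (h : Q (s.setArr a (i.eval s) (e.eval s))) :
    Runs (.write a i e) s (i.cost s + e.cost s + 1) Q :=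
  ⟨_, _, .write s a i e, le_rfl, h⟩

theorem Runs.seq {c₁ c₂ : Program} {s : State} {T₁ T₂ : ℕ} {Q₁ Q₂ : State → Prop}
    (h₁ : Runs c₁ s T₁ Q₁) (h₂ : ∀ s', Q₁ s' → Runs c₂ s' T₂ Q₂) :
    Runs (.seq c₁ c₂) s (T₁ + T₂) Q₂ := by
  obtain ⟨s', t, h, ht, hs⟩ := h₁
  obtain ⟨s'', t', h', ht', hs'⟩ := h₂ s' hs
  exact ⟨s'', _, .seq h h', add_le_add ht ht', hs'⟩

theorem Runs.ite {e : Expr} {c₁ c₂ : Program} {s : State} {T : ℕ} {Q : State → Prop}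
    (h₁ : 0 < e.eval s → Runs c₁ s T Q) (h₂ : e.eval s ≤ 0 → Runs c₂ s T Q) :
    Runs (.ite e c₁ c₂) s (e.cost s + 1 + T) Q := by
  rcases lt_or_ge 0 (e.eval s) with he | he
  · obtain ⟨s', t, h, ht, hs⟩ := h₁ he
    exact ⟨s', _, .ite_pos he h, by omega, hs⟩
  · obtain ⟨s', t, h, ht, hs⟩ := h₂ he
    exact ⟨s', _, .ite_neg he h, by omega, hs⟩

/-- A loop that is iterated `n` times, with the invariant `Inv k` after `k` iterations. -/
theorem Runs.loop {e : Expr} {c : Program} {s : State} {n T₀ T : ℕ} {Inv : ℕ → State → Prop}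
    (hpos : ∀ k < n, ∀ s, Inv k s → 0 < e.eval s) (hend : ∀ s, Inv n s → e.eval s ≤ 0)
    (hcost : ∀ k ≤ n, ∀ s, Inv k s → e.cost s ≤ T₀)
    (hbody : ∀ k < n, ∀ s, Inv k s → Runs c s T (Inv (k + 1))) (hs : Inv 0 s) :
    Runs (.loop e c) s ((n + 1) * (T₀ + 1 + T)) (Inv n) := by
  suffices H : ∀ m k s, k + m = n → Inv k s →
      Runs (.loop e c) s ((m + 1) * (T₀ + 1 + T)) (Inv n) from H n 0 s (by omega) hs
  intro m
  induction m with
  | zero =>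
    rintro k s rfl hk
    have hex : Exec (.loop e c) s s (e.cost s + 1) := by
      constructor
      exact hend s hk
    exact ⟨s, _, hex, by have := hcost _ le_rfl s hk; omega, hk⟩
  | succ m ih =>
    intro k s hkm hk
    obtain ⟨s', t, h, ht, hs'⟩ := hbody k (by omega) s hk
    obtain ⟨s'', t', h', ht', hs''⟩ := ih (k + 1) s' (by omega) hs'
    refine ⟨s'', _, .loop_step (hpos k (by omega) s hk) h h', ?_, hs''⟩
    have := hcost k (by omega) s hk
    rw [add_mul, one_mul]; omega

/-- The memories `s` and `s'` agree on the registers below `d` and on the arrays. -/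
def EqBelow (d : ℕ) (s s' : State) : Prop := (∀ r < d, s'.reg r = s.reg r) ∧ s'.arr = s.arr

theorem EqBelow.refl (d : ℕ) (s : State) : EqBelow d s s := ⟨fun _ _ => rfl, rfl⟩

theorem EqBelow.trans {d d' : ℕ} {s s' s'' : State} (h : EqBelow d s s') (h' : EqBelow d' s' s'')
    (hd : d ≤ d') : EqBelow d s s'' :=
  ⟨fun r hr => (h'.1 r (hr.trans_le hd)).trans (h.1 r hr), h'.2.trans h.2⟩

theorem EqBelow.setReg {d v : ℕ} {s s' : State} (h : EqBelow d s s') (hv : d ≤ v) (z : ℤ) :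
    EqBelow d s (s'.setReg v z) :=
  ⟨fun r hr => by
    rw [State.setReg]; dsimp only
    rw [Function.update_of_ne (by omega)]; exact h.1 r hr, h.2⟩

@[simp] theorem setReg_reg_self (s : State) (v : ℕ) (z : ℤ) : (s.setReg v z).reg v = z := by
  simp [State.setReg]

theorem setReg_reg_of_ne (s : State) {v w : ℕ} (z : ℤ) (h : w ≠ v) :
    (s.setReg v z).reg w = s.reg w := by
  simp [State.setReg, h]

/-! ### Polynomial-time functions -/

/-- A type of data that a program works on: finitely many integer variables, kept in registers,
arrays, which are never modified, and a size, in which running times are measured. -/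
class Ctx (Γ : Type) where
  /-- the names of the variables -/
  ι : Type
  /-- the values of the variables -/
  var : ι → Γ → ℤ
  /-- the contents of the arrays -/
  arr : Γ → ℕ → ℤ → ℤ
  /-- the size of the data -/
  size : Γ → ℕ

/-- Data extended by one more integer variable. -/
instance Ctx.prod (Γ : Type) [Ctx Γ] : Ctx (Γ × ℤ) where
  ι := Option (Ctx.ι Γ)
  var v q := v.elim q.2 fun v => Ctx.var v q.1
  arr q := Ctx.arr q.1
  size q := Ctx.size q.1 + bitLen q.2

/-- `b` is bounded by a polynomial in the size of the data. -/
def PolyBdd {Γ : Type} [Ctx Γ] (b : Γ → ℕ) : Prop :=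
  ∃ p : Polynomial ℕ, ∀ γ, b γ ≤ p.eval (Ctx.size γ)

theorem eval_mono (p : Polynomial ℕ) {m n : ℕ} (h : m ≤ n) : p.eval m ≤ p.eval n := by
  rw [Polynomial.eval_eq_sum_range, Polynomial.eval_eq_sum_range]
  gcongr

section PolyBdd

variable {Γ : Type} [Ctx Γ]

theorem PolyBdd.mono {a b : Γ → ℕ} (hb : PolyBdd b) (h : ∀ γ, a γ ≤ b γ) : PolyBdd a :=
  hb.imp fun _ hp γ => (h γ).trans (hp γ)

theorem PolyBdd.const (n : ℕ) : PolyBdd fun _ : Γ => n := ⟨Polynomial.C n, fun γ => by simp⟩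

theorem PolyBdd.size : PolyBdd fun γ : Γ => Ctx.size γ := ⟨Polynomial.X, fun γ => by simp⟩

theorem PolyBdd.add {a b : Γ → ℕ} (ha : PolyBdd a) (hb : PolyBdd b) :
    PolyBdd fun γ => a γ + b γ := by
  obtain ⟨p, hp⟩ := ha
  obtain ⟨q, hq⟩ := hb
  exact ⟨p + q, fun γ => by rw [Polynomial.eval_add]; exact add_le_add (hp γ) (hq γ)⟩

theorem PolyBdd.mul {a b : Γ → ℕ} (ha : PolyBdd a) (hb : PolyBdd b) :
    PolyBdd fun γ => a γ * b γ := by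
  obtain ⟨p, hp⟩ := ha
  obtain ⟨q, hq⟩ := hb
  exact ⟨p * q, fun γ => by rw [Polynomial.eval_mul]; exact Nat.mul_le_mul (hp γ) (hq γ)⟩

theorem PolyBdd.eval {a : Γ → ℕ} (ha : PolyBdd a) (p : Polynomial ℕ) :
    PolyBdd fun γ => p.eval (a γ) := by
  obtain ⟨q, hq⟩ := ha
  exact ⟨p.comp q, fun γ => by rw [Polynomial.eval_comp]; exact eval_mono p (hq γ)⟩

theorem PolyBdd.comp {Δ : Type} [Ctx Δ] {b : Γ → ℕ} (hb : PolyBdd b) {π : Δ → Γ}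
    (hπ : PolyBdd fun δ => Ctx.size (π δ)) : PolyBdd fun δ => b (π δ) := by
  obtain ⟨p, hp⟩ := hb
  exact (hπ.eval p).mono fun δ => hp (π δ)

end PolyBdd

/-- The data `γ` is stored in the memory `s`, with variable `v` in register `ρ v`. -/
def Holds {Γ : Type} [Ctx Γ] (ρ : Ctx.ι Γ → ℕ) (γ : Γ) (s : State) : Prop :=
  (∀ v, s.reg (ρ v) = Ctx.var v γ) ∧ s.arr = Ctx.arr γ

theorem Holds.of_eqBelow {Γ : Type} [Ctx Γ] {ρ : Ctx.ι Γ → ℕ} {γ : Γ} {s s' : State} {d : ℕ}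
    (h : Holds ρ γ s) (hρ : ∀ v, ρ v < d) (hs : EqBelow d s s') : Holds ρ γ s' :=
  ⟨fun v => (hs.1 _ (hρ v)).trans (h.1 v), hs.2.trans h.2⟩

/-- `F` has values of polynomial bit length and can be computed in polynomial time: wherever the
variables are kept, there is a program that puts the value of `F` into a given register `d` and
does not change the arrays and the registers below `d`. -/
def Comp {Γ : Type} [Ctx Γ] (F : Γ → ℤ) : Prop :=
  (PolyBdd fun γ => bitLen (F γ)) ∧
    ∀ (d : ℕ) (ρ : Ctx.ι Γ → ℕ), (∀ v, ρ v < d) → ∃ (c : Program) (T : Γ → ℕ), PolyBdd T ∧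
      ∀ γ s, Holds ρ γ s → Runs c s (T γ) fun s' => s'.reg d = F γ ∧ EqBelow d s s'

namespace Comp

variable {Γ : Type} [Ctx Γ]

theorem of_eq {F G : Γ → ℤ} (hF : Comp F) (h : ∀ γ, G γ = F γ) : Comp G := by
  rwa [show G = F from funext h]

theorem const (z : ℤ) : Comp fun _ : Γ => z := by
  refine ⟨.const _, fun d ρ _ => ⟨.assign d (.const z), fun _ => bitLen z + 1, .const _, ?_⟩⟩
  intro γ s _
  exact Runs.assign ⟨by simp [Expr.eval], (EqBelow.refl d s).setReg le_rfl _⟩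

theorem var (v : Ctx.ι Γ) (hv : PolyBdd fun γ : Γ => bitLen (Ctx.var v γ)) :
    Comp fun γ : Γ => Ctx.var v γ := by
  refine ⟨hv, fun d ρ _ => ⟨.assign d (.reg (ρ v)), _, hv.add (.const 1), fun γ s h => ?_⟩⟩
  refine (Runs.assign (Q := fun s' => s'.reg d = Ctx.var v γ ∧ EqBelow d s s')
    ⟨?_, (EqBelow.refl d s).setReg le_rfl _⟩).mono ?_ fun _ h => h
  · simp [Expr.eval, h.1]
  · simp [Expr.cost, h.1]

/-- The most recent variable. -/
theorem snd : Comp fun q : Γ × ℤ => q.2 :=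
  var (Γ := Γ × ℤ) none (PolyBdd.size.mono fun _ => Nat.le_add_left _ _)

/-- Reading a cell of an array whose cells have polynomial bit length. -/
theorem read {a : ℕ} (ha : PolyBdd fun q : Γ × ℤ => bitLen (Ctx.arr q.1 a q.2)) {F : Γ → ℤ}
    (hF : Comp F) : Comp fun γ => Ctx.arr γ a (F γ) := by
  have hb : PolyBdd fun γ => bitLen (Ctx.arr γ a (F γ)) :=
    ha.comp (π := fun γ => (γ, F γ)) (PolyBdd.size.add hF.1)
  refine ⟨hb, fun d ρ hρ => ?_⟩
  obtain ⟨c, T, hT, hc⟩ := hF.2 d ρ hρ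
  refine ⟨.seq c (.assign d (.read a (.reg d))), _,
    hT.add ((hF.1.add hb).add (.const 1)), fun γ s h => (hc γ s h).seq fun s₁ h₁ => ?_⟩
  have harr : s₁.arr = Ctx.arr γ := h₁.2.2.trans h.2
  refine (Runs.assign (Q := fun s' => s'.reg d = _ ∧ EqBelow d s s')
    ⟨?_, h₁.2.setReg le_rfl _⟩).mono ?_ fun _ h => h
  · simp [Expr.eval, h₁.1, harr]
  · simp [Expr.cost, Expr.eval, h₁.1, harr]

/-- An arithmetic operation of the machine, applied to two computable operands. -/
theorem binop (op : ℤ → ℤ → ℤ) (E : Expr → Expr → Expr)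
    (heval : ∀ s e₁ e₂, (E e₁ e₂).eval s = op (e₁.eval s) (e₂.eval s))
    (hcost : ∀ s e₁ e₂, (E e₁ e₂).cost s =
      e₁.cost s + e₂.cost s + bitLen (op (e₁.eval s) (e₂.eval s)))
    (hop : ∀ a b, bitLen (op a b) ≤ bitLen a + bitLen b)
    {F G : Γ → ℤ} (hF : Comp F) (hG : Comp G) : Comp fun γ => op (F γ) (G γ) := by
  refine ⟨(hF.1.add hG.1).mono fun γ => hop _ _, fun d ρ hρ => ?_⟩
  obtain ⟨c, T, hT, hc⟩ := hF.2 d ρ hρ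
  obtain ⟨c', T', hT', hc'⟩ := hG.2 (d + 1) ρ fun v => (hρ v).trans (Nat.lt_succ_self d)
  refine ⟨.seq c (.seq c' (.assign d (E (.reg d) (.reg (d + 1))))), _,
    hT.add (hT'.add (((hF.1.add hG.1).add (hF.1.add hG.1)).add (.const 1))),
    fun γ s h => (hc γ s h).seq fun s₁ h₁ =>
      (hc' γ s₁ (h.of_eqBelow hρ h₁.2)).seq fun s₂ h₂ => ?_⟩
  have hd : s₂.reg d = F γ := (h₂.2.1 d (Nat.lt_succ_self d)).trans h₁.1
  refine (Runs.assign (Q := fun s' => s'.reg d = _ ∧ EqBelow d s s')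
    ⟨?_, (h₁.2.trans h₂.2 (Nat.le_succ d)).setReg le_rfl _⟩).mono ?_ fun _ h => h
  · simp [heval, Expr.eval, hd, h₂.1]
  · rw [hcost]
    have := hop (F γ) (G γ)
    simp only [Expr.cost, Expr.eval, hd, h₂.1]
    omega

theorem add {F G : Γ → ℤ} (hF : Comp F) (hG : Comp G) : Comp fun γ => F γ + G γ :=
  binop (· + ·) .add (fun _ _ _ => rfl) (fun _ _ _ => rfl) bitLen_add hF hG

theorem sub {F G : Γ → ℤ} (hF : Comp F) (hG : Comp G) : Comp fun γ => F γ - G γ :=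
  binop (· - ·) .sub (fun _ _ _ => rfl) (fun _ _ _ => rfl) bitLen_sub hF hG

theorem mul {F G : Γ → ℤ} (hF : Comp F) (hG : Comp G) : Comp fun γ => F γ * G γ :=
  binop (· * ·) .mul (fun _ _ _ => rfl) (fun _ _ _ => rfl) bitLen_mul hF hG

theorem div {F G : Γ → ℤ} (hF : Comp F) (hG : Comp G) : Comp fun γ => F γ / G γ :=
  binop (· / ·) .div (fun _ _ _ => rfl) (fun _ _ _ => rfl)
    (fun a b => (bitLen_div a b).trans (Nat.le_add_right _ _)) hF hG

theorem ite_pos {H F G : Γ → ℤ} (hH : Comp H) (hF : Comp F) (hG : Comp G) :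
    Comp fun γ => if 0 < H γ then F γ else G γ := by
  refine ⟨(hF.1.add hG.1).mono fun γ => by dsimp only; split_ifs <;> omega, fun d ρ hρ => ?_⟩
  obtain ⟨c, T, hT, hc⟩ := hH.2 d ρ hρ
  obtain ⟨c₁, T₁, hT₁, hc₁⟩ := hF.2 d ρ hρ
  obtain ⟨c₂, T₂, hT₂, hc₂⟩ := hG.2 d ρ hρ
  refine ⟨.seq c (.ite (.reg d) c₁ c₂), _, hT.add ((hH.1.add (.const 1)).add (hT₁.add hT₂)),
    fun γ s h => (hc γ s h).seq fun s₀ h₀ => ?_⟩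
  have hh := h.of_eqBelow hρ h₀.2
  refine (Runs.ite (e := .reg d) (T := T₁ γ + T₂ γ) (fun h => ?_) fun h => ?_).mono
    (by simp [Expr.cost, h₀.1]) fun _ h => h
  · rw [Expr.eval, h₀.1] at h
    exact (hc₁ γ s₀ hh).mono (Nat.le_add_right _ _) fun s' h' =>
      ⟨h'.1.trans (if_pos h).symm, h₀.2.trans h'.2 le_rfl⟩
  · rw [Expr.eval, h₀.1] at h
    exact (hc₂ γ s₀ hh).mono (Nat.le_add_left _ _) fun s' h' =>
      ⟨h'.1.trans (if_neg (not_lt.2 h)).symm, h₀.2.trans h'.2 le_rfl⟩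

end Comp

/-- The data `π δ` is part of the data `δ`: it has the same arrays, and its variables are among
those of `δ`. -/
def IsPart {Δ Γ : Type} [Ctx Δ] [Ctx Γ] (π : Δ → Γ) : Prop :=
  (PolyBdd fun δ => Ctx.size (π δ)) ∧ (∀ δ, Ctx.arr δ = Ctx.arr (π δ)) ∧
    ∃ e : Ctx.ι Γ → Ctx.ι Δ, ∀ v δ, Ctx.var (e v) δ = Ctx.var v (π δ)

theorem IsPart.id {Γ : Type} [Ctx Γ] : IsPart fun γ : Γ => γ :=
  ⟨.size, fun _ => rfl, fun v => v, fun _ _ => rfl⟩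

theorem IsPart.fst {Δ Γ : Type} [Ctx Δ] [Ctx Γ] {π : Δ → Γ} (h : IsPart π) :
    IsPart fun q : Δ × ℤ => π q.1 := by
  obtain ⟨h₁, h₂, e, he⟩ := h
  exact ⟨h₁.comp (π := Prod.fst) (PolyBdd.size.mono fun _ => Nat.le_add_right _ _),
    fun q => h₂ q.1, fun v => some (e v), fun v q => he v q.1⟩

namespace Comp

variable {Γ Δ : Type} [Ctx Γ] [Ctx Δ]

/-- A function of a part of the data, and of a further argument. -/
theorem call {F : Γ → ℤ → ℤ} (hF : Comp fun q : Γ × ℤ => F q.1 q.2) {π : Δ → Γ} (hπ : IsPart π)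
    {G : Δ → ℤ} (hG : Comp G) : Comp fun δ => F (π δ) (G δ) := by
  obtain ⟨hsize, harr, e, he⟩ := hπ
  have hsize' : PolyBdd fun δ => Ctx.size ((π δ, G δ) : Γ × ℤ) := hsize.add hG.1
  have hb : PolyBdd fun δ => bitLen (F (π δ) (G δ)) := hF.1.comp (π := fun δ => (π δ, G δ)) hsize'
  refine ⟨hb, fun d ρ hρ => ?_⟩
  obtain ⟨c, T, hT, hc⟩ := hG.2 d ρ hρ
  obtain ⟨c', T', hT', hc'⟩ := hF.2 (d + 1) (fun v => v.elim d fun v => ρ (e v)) <| by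
    rintro (_ | v)
    · exact Nat.lt_succ_self d
    · exact (hρ _).trans (Nat.lt_succ_self d)
  refine ⟨.seq c (.seq c' (.assign d (.reg (d + 1)))), _,
    hT.add ((hT'.comp (π := fun δ => (π δ, G δ)) hsize').add (hb.add (.const 1))),
    fun δ s h => (hc δ s h).seq fun s₁ h₁ => (hc' (π δ, G δ) s₁ ⟨?_, ?_⟩).seq fun s₂ h₂ => ?_⟩
  · rintro (_ | v)
    · exact h₁.1
    · exact (h₁.2.1 _ (hρ _)).trans ((h.1 _).trans (he v δ))
  · exact h₁.2.2.trans (h.2.trans (harr δ))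
  · refine (Runs.assign (Q := fun s' => s'.reg d = _ ∧ EqBelow d s s')
      ⟨?_, (h₁.2.trans h₂.2 (Nat.le_succ d)).setReg le_rfl _⟩).mono ?_ fun _ h => h
    · simp [Expr.eval, h₂.1]
    · simp [Expr.cost, h₂.1]

theorem part {F : Γ → ℤ} (hF : Comp F) {π : Δ → Γ} (hπ : IsPart π) : Comp fun δ => F (π δ) := by
  obtain ⟨hsize, harr, e, he⟩ := hπ
  refine ⟨hF.1.comp hsize, fun d ρ hρ => ?_⟩
  obtain ⟨c, T, hT, hc⟩ := hF.2 d (fun v => ρ (e v)) fun v => hρ _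
  exact ⟨c, _, hT.comp hsize, fun δ s h =>
    hc (π δ) s ⟨fun v => (h.1 _).trans (he v δ), h.2.trans (harr δ)⟩⟩

theorem fst {F : Γ → ℤ} (hF : Comp F) : Comp fun q : Γ × ℤ => F q.1 := hF.part IsPart.id.fst

/-- A function of a part of the data, and of two further arguments. -/
theorem call₂ {F : Γ → ℤ → ℤ → ℤ} (hF : Comp fun q : (Γ × ℤ) × ℤ => F q.1.1 q.1.2 q.2)
    {π : Δ → Γ} (hπ : IsPart π) {G H : Δ → ℤ} (hG : Comp G) (hH : Comp H) :
    Comp fun δ => F (π δ) (G δ) (H δ) := by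
  -- the first argument is bound to a new variable, which becomes part of the data
  have hπ' : IsPart fun q : Δ × ℤ => (π q.1, q.2) := by
    obtain ⟨hsize, harr, e, he⟩ := hπ
    refine ⟨?_, fun q => harr q.1, fun v => v.elim none fun v => some (e v), ?_⟩
    · exact (hsize.comp (π := Prod.fst) (PolyBdd.size.mono fun _ => Nat.le_add_right _ _)).add
        Comp.snd.1
    · rintro (_ | v) q
      · rfl
      · exact he v q.1
  exact call (F := fun δ z => F (π δ) z (H δ))
    (call (F := fun (q : Γ × ℤ) z => F q.1 q.2 z) hF hπ' hH.fst) IsPart.id hG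

end Comp

/-- `iter n a f` is the value of the accumulator `a` after `a := f x a` for `x = 0, …, n - 1`. -/
def iter (n : ℕ) (a : ℤ) (f : ℤ → ℤ → ℤ) : ℤ := Nat.rec a (fun x acc => f x acc) n

@[simp] theorem iter_zero (a : ℤ) (f : ℤ → ℤ → ℤ) : iter 0 a f = a := rfl

theorem iter_succ (n : ℕ) (a : ℤ) (f : ℤ → ℤ → ℤ) : iter (n + 1) a f = f n (iter n a f) := rfl

namespace Comp

variable {Γ : Type} [Ctx Γ]

/-- A loop with polynomially many iterations, if the accumulator keeps a polynomial bit length. -/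
theorem iter {N a : Γ → ℤ} {f : Γ → ℤ → ℤ → ℤ} (hN : Comp N)
    (hN' : PolyBdd fun γ => (N γ).toNat) (ha : Comp a)
    (hf : Comp fun q : (Γ × ℤ) × ℤ => f q.1.1 q.1.2 q.2) {B : Γ → ℕ} (hB : PolyBdd B)
    (hle : ∀ γ, ∀ k ≤ (N γ).toNat, bitLen (RAM.iter k (a γ) (f γ)) ≤ B γ) :
    Comp fun γ => RAM.iter (N γ).toNat (a γ) (f γ) := by
  refine ⟨hB.mono fun γ => hle γ _ le_rfl, fun d ρ hρ => ?_⟩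
  -- register `d` holds the number of iterations, `d + 1` the accumulator, `d + 2` the counter
  obtain ⟨c, T, hT, hc⟩ := hN.2 d ρ hρ
  obtain ⟨c₁, T₁, hT₁, hc₁⟩ := ha.2 (d + 1) ρ fun v => by have := hρ v; omega
  obtain ⟨c₂, T₂, ⟨p, hp⟩, hc₂⟩ := hf.2 (d + 3)
    (fun v => v.elim (d + 1) fun v => v.elim (d + 2) ρ) <| by
      rintro (_ | _ | v)
      · exact show d + 1 < d + 3 by omega
      · exact show d + 2 < d + 3 by omega
      · exact show ρ v < d + 3 by have := hρ v; omega
  set body : Program := .seq c₂ (.seq (.assign (d + 1) (.reg (d + 3)))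
    (.assign (d + 2) (.add (.reg (d + 2)) (.const 1)))) with hbody
  set e : Expr := .sub (.reg d) (.reg (d + 2)) with he
  have hsz : PolyBdd fun γ => Ctx.size γ + ((N γ).toNat + 1) + B γ :=
    (PolyBdd.size.add (hN'.add (.const 1))).add hB
  refine ⟨.seq c (.seq c₁ (.seq (.assign (d + 2) (.const 0))
      (.seq (.loop e body) (.assign d (.reg (d + 1)))))), _,
    hT.add (hT₁.add ((PolyBdd.const 2).add (((hN'.add (.const 1)).mul
      ((((PolyBdd.const 2).mul (hN.1.add (hN'.add (.const 1)))).add (.const 1)).add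
      ((hsz.eval p).add ((hB.add (.const 1)).add (((PolyBdd.const 2).mul hN').add
        (.const 6)))))).add (hB.add (.const 1))))), fun γ s h => (hc γ s h).seq fun s₀ h₀ =>
    (hc₁ γ s₀ (h.of_eqBelow hρ h₀.2)).seq fun s₁ h₁ => ?_⟩
  have hN₁ : s₁.reg d = N γ := (h₁.2.1 d (Nat.lt_succ_self d)).trans h₀.1
  have hs₁ : EqBelow d s s₁ := h₀.2.trans h₁.2 (Nat.le_succ d)
  let Inv : ℕ → State → Prop := fun k s' => s'.reg d = N γ ∧
    s'.reg (d + 1) = RAM.iter k (a γ) (f γ) ∧ s'.reg (d + 2) = k ∧ EqBelow d s s'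
  have hk : ∀ k : ℕ, bitLen k ≤ k + 1 := fun k => bitLen_le_natAbs k
  refine Runs.seq (T₁ := 2) (Q₁ := Inv 0) (Runs.assign ⟨?_, ?_, ?_, hs₁.setReg (by omega) _⟩)
    fun s₂ h₂ => Runs.seq (Runs.loop (Inv := Inv) ?_ ?_ ?_ ?_ h₂) fun s₃ h₃ => ?_
  · rw [setReg_reg_of_ne _ _ (by omega), hN₁]
  · rw [setReg_reg_of_ne _ _ (by omega), h₁.1, iter_zero]
  · simp [Expr.eval]
  · rintro k hk s' ⟨h₁, -, h₂, -⟩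
    simp only [he, Expr.eval, h₁, h₂]; omega
  · rintro s' ⟨h₁, -, h₂, -⟩
    simp only [he, Expr.eval, h₁, h₂]; omega
  · rintro k hkn s' ⟨h₁, -, h₂, -⟩
    simp only [he, Expr.cost, Expr.eval, h₁, h₂]
    have := bitLen_sub (N γ) k
    have := hk k
    omega
  · rintro k hkn s' ⟨h₁, h₂, h₃, h₄⟩
    have hbits := hle γ k hkn.le
    have hbits' := hle γ (k + 1) hkn
    refine (((hc₂ ((γ, (k : ℤ)), RAM.iter k (a γ) (f γ)) s' ⟨?_, h₄.2.trans h.2⟩).mono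
      (T' := p.eval (Ctx.size γ + ((N γ).toNat + 1) + B γ)) ?_ fun _ h => h).seq
      (T₂ := B γ + 1 + (2 * (N γ).toNat + 6)) fun s₄ h₅ => ?_)
    · rintro (_ | _ | v)
      · exact h₂
      · exact h₃
      · exact (h₄.1 _ (hρ v)).trans (h.1 v)
    · refine (hp _).trans (eval_mono p ?_)
      have := hk k
      change Ctx.size γ + bitLen (k : ℤ) + bitLen (RAM.iter k (a γ) (f γ)) ≤ _
      omega
    · have h₆ : s₄.reg (d + 3) = RAM.iter (k + 1) (a γ) (f γ) := h₅.1
      have hb := h₅.2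
      refine (Runs.seq (T₂ := 2 * (N γ).toNat + 6) (Runs.assign (Q := fun s' => s'.reg d = N γ ∧
        s'.reg (d + 1) = RAM.iter (k + 1) (a γ) (f γ) ∧ s'.reg (d + 2) = k ∧ EqBelow d s s')
        ⟨?_, ?_, ?_, (h₄.trans hb (by omega)).setReg (by omega) _⟩) fun s₅ h₇ => ?_).mono
        ?_ fun _ h => h
      · rw [setReg_reg_of_ne _ _ (by omega), hb.1 _ (by omega), h₁]
      · simp [Expr.eval, h₆]
      · rw [setReg_reg_of_ne _ _ (by omega), hb.1 _ (by omega), h₃]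
      · obtain ⟨h₇, h₈, h₉, h₁₀⟩ := h₇
        refine (Runs.assign (Q := Inv (k + 1))
          ⟨?_, ?_, ?_, h₁₀.setReg (by omega) _⟩).mono ?_ fun _ h => h
        · rw [setReg_reg_of_ne _ _ (by omega), h₇]
        · rw [setReg_reg_of_ne _ _ (by omega), h₈]
        · simp [Expr.eval, h₉]
        · simp only [Expr.cost, Expr.eval, h₉]
          have h1 := hk k
          have h2 := hk (k + 1)
          have h3 : bitLen 1 = 2 := by decide
          push_cast at h2
          omega
      · simp only [Expr.cost, h₆]
        omega
  · refine (Runs.assign (Q := fun s' => s'.reg d = _ ∧ EqBelow d s s')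
      ⟨?_, h₃.2.2.2.setReg le_rfl _⟩).mono ?_ fun _ h => h
    · simp [Expr.eval, h₃.2.1]
    · simp only [Expr.cost, h₃.2.1]
      have := hle γ _ le_rfl
      omega

end Comp

end RAM

namespace RAM

/-! ### Predicates, sums, products and maximizers -/

/-- The predicate `P` is decided by the sign of a computable function. -/
def CompPred {Γ : Type} [Ctx Γ] (P : Γ → Prop) : Prop := ∃ b : Γ → ℤ, Comp b ∧ ∀ γ, 0 < b γ ↔ P γ

section CompPred

variable {Γ : Type} [Ctx Γ]

theorem CompPred.of_iff {P Q : Γ → Prop} (hP : CompPred P) (h : ∀ γ, Q γ ↔ P γ) : CompPred Q :=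
  hP.imp fun _ hb => ⟨hb.1, fun γ => (hb.2 γ).trans (h γ).symm⟩

theorem Comp.ite {P : Γ → Prop} [∀ γ, Decidable (P γ)] {F G : Γ → ℤ} (hP : CompPred P)
    (hF : Comp F) (hG : Comp G) : Comp fun γ => if P γ then F γ else G γ := by
  obtain ⟨b, hb, h⟩ := hP
  exact (hb.ite_pos hF hG).of_eq fun γ => by simp only [h]

theorem CompPred.lt {F G : Γ → ℤ} (hF : Comp F) (hG : Comp G) : CompPred fun γ => F γ < G γ :=
  ⟨_, hG.sub hF, fun _ => sub_pos⟩

theorem CompPred.not {P : Γ → Prop} (hP : CompPred P) : CompPred fun γ => ¬ P γ := by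
  obtain ⟨b, hb, h⟩ := hP
  exact ⟨_, (Comp.const 1).sub hb, fun γ => by dsimp only; rw [← h]; omega⟩

theorem CompPred.le {F G : Γ → ℤ} (hF : Comp F) (hG : Comp G) : CompPred fun γ => F γ ≤ G γ :=
  (CompPred.lt hG hF).not.of_iff fun _ => not_lt.symm

theorem CompPred.and {P Q : Γ → Prop} (hP : CompPred P) (hQ : CompPred Q) :
    CompPred fun γ => P γ ∧ Q γ := by
  obtain ⟨b, hb, h⟩ := hP
  obtain ⟨b', hb', h'⟩ := hQ
  refine ⟨_, hb.ite_pos hb' (.const 0), fun γ => ?_⟩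
  dsimp only
  rw [← h, ← h']; split_ifs with hγ <;> simp [hγ]

theorem CompPred.or {P Q : Γ → Prop} (hP : CompPred P) (hQ : CompPred Q) :
    CompPred fun γ => P γ ∨ Q γ :=
  (hP.not.and hQ.not).not.of_iff fun _ => by rw [← not_or, not_not]

theorem CompPred.eq {F G : Γ → ℤ} (hF : Comp F) (hG : Comp G) : CompPred fun γ => F γ = G γ :=
  ((CompPred.le hF hG).and (.le hG hF)).of_iff fun _ => le_antisymm_iff

theorem CompPred.part {Δ : Type} [Ctx Δ] {P : Γ → Prop} (hP : CompPred P) {π : Δ → Γ}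
    (hπ : IsPart π) : CompPred fun δ => P (π δ) := by
  obtain ⟨b, hb, h⟩ := hP
  exact ⟨_, hb.part hπ, fun δ => h (π δ)⟩

theorem CompPred.fst {P : Γ → Prop} (hP : CompPred P) : CompPred fun q : Γ × ℤ => P q.1 :=
  hP.part IsPart.id.fst

theorem CompPred.call {Δ : Type} [Ctx Δ] {P : Γ → ℤ → Prop}
    (hP : CompPred fun q : Γ × ℤ => P q.1 q.2) {π : Δ → Γ} (hπ : IsPart π) {G : Δ → ℤ}
    (hG : Comp G) : CompPred fun δ => P (π δ) (G δ) := by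
  obtain ⟨b, hb, h⟩ := hP
  exact ⟨_, Comp.call (F := fun γ z => b (γ, z)) hb hπ hG, fun δ => h (π δ, G δ)⟩

theorem Comp.max {F G : Γ → ℤ} (hF : Comp F) (hG : Comp G) : Comp fun γ => max (F γ) (G γ) :=
  (Comp.ite (CompPred.le hF hG) hG hF).of_eq fun _ => max_def _ _

theorem Comp.neg {F : Γ → ℤ} (hF : Comp F) : Comp fun γ => -F γ :=
  ((Comp.const 0).sub hF).of_eq fun _ => (zero_sub _).symm

end CompPred

/-- A loop that accumulates, with an operation under which bit lengths are subadditive, numbers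
whose bit lengths are bounded independently of the accumulator. -/
theorem Comp.iter_op {Γ : Type} [Ctx Γ] (op : ℤ → ℤ → ℤ)
    (hop : ∀ a b, bitLen (op a b) ≤ bitLen a + bitLen b)
    (hopc : ∀ {Δ : Type} [Ctx Δ] {F G : Δ → ℤ}, Comp F → Comp G → Comp fun δ => op (F δ) (G δ))
    {N : Γ → ℤ} {f : Γ → ℤ → ℤ → ℤ} (a : ℤ) (hN : Comp N) (hN' : PolyBdd fun γ => (N γ).toNat)
    (hf : Comp fun q : (Γ × ℤ) × ℤ => f q.1.1 q.1.2 q.2) {B : Γ → ℕ} (hB : PolyBdd B)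
    (hle : ∀ γ, ∀ x < (N γ).toNat, ∀ z, bitLen (f γ x z) ≤ B γ) :
    Comp fun γ => RAM.iter (N γ).toNat a fun x z => op z (f γ x z) := by
  refine Comp.iter hN hN' (.const a) (hopc Comp.snd hf)
    ((PolyBdd.const (bitLen a)).add (hN'.mul hB)) fun γ k hk => ?_
  refine le_trans (b := bitLen a + k * B γ) ?_ (by gcongr)
  induction k with
  | zero => simp
  | succ k ih =>
    rw [iter_succ]
    have := hop (RAM.iter k a fun x z => op z (f γ x z))
      (f γ k (RAM.iter k a fun x z => op z (f γ x z)))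
    have := hle γ k hk (RAM.iter k a fun x z => op z (f γ x z))
    have := ih (by omega)
    rw [add_mul, one_mul]; omega

/-- The sum of `f x` over `0 ≤ x < N`. -/
def sumZ (N : ℤ) (f : ℤ → ℤ) : ℤ := ∑ x ∈ Finset.range N.toNat, f x

/-- The product of `f x` over `0 ≤ x < N`. -/
def prodZ (N : ℤ) (f : ℤ → ℤ) : ℤ := ∏ x ∈ Finset.range N.toNat, f x

theorem sumZ_natCast (n : ℕ) (f : ℤ → ℤ) : sumZ n f = ∑ j : Fin n, f (j : ℕ) := by
  rw [sumZ, Int.toNat_natCast, Finset.sum_range]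

open Classical in
/-- A number `0 ≤ x < N` that satisfies `P` and among these maximizes `f`; it is `-1` if there is
no such number. -/
noncomputable def argmaxZ (N : ℤ) (P : ℤ → Prop) (f : ℤ → ℤ) : ℤ :=
  iter N.toNat (-1) fun x z => if P x ∧ (z < 0 ∨ f z < f x) then x else z

theorem argmaxZ_spec (n : ℕ) (P : ℤ → Prop) (f : ℤ → ℤ) :
    (argmaxZ n P f = -1 ∧ ∀ x < n, ¬ P (x : ℕ)) ∨
      ∃ m < n, argmaxZ n P f = (m : ℕ) ∧ P (m : ℕ) ∧ ∀ x < n, P (x : ℕ) → f (x : ℕ) ≤ f m := by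
  classical
  rw [argmaxZ, Int.toNat_natCast]
  induction n with
  | zero => exact Or.inl ⟨rfl, fun x hx => absurd hx (Nat.not_lt_zero x)⟩
  | succ n ih =>
    rw [iter_succ]
    set z := iter n (-1) fun x z => if P x ∧ (z < 0 ∨ f z < f x) then x else z
    rcases ih with ⟨hz, hP⟩ | ⟨m, hm, hz, hPm, hmax⟩
    · by_cases hn : P n
      · refine Or.inr ⟨n, n.lt_succ_self, by simp [hn, hz], hn, fun x hx hPx => ?_⟩
        rcases (Nat.lt_succ_iff_lt_or_eq.1 hx) with h | rfl
        · exact absurd hPx (hP x h)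
        · exact le_rfl
      · refine Or.inl ⟨by simp [hn, hz], fun x hx => ?_⟩
        rcases (Nat.lt_succ_iff_lt_or_eq.1 hx) with h | rfl
        · exact hP x h
        · exact hn
    · right
      by_cases hn : P n ∧ f m < f n
      · refine ⟨n, n.lt_succ_self, by simp [hn, hz], hn.1, fun x hx hPx => ?_⟩
        rcases (Nat.lt_succ_iff_lt_or_eq.1 hx) with h | rfl
        · exact (hmax x h hPx).trans hn.2.le
        · exact le_rfl
      · refine ⟨m, hm.trans n.lt_succ_self, ?_, hPm, fun x hx hPx => ?_⟩
        · rw [if_neg, hz]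
          rw [hz]
          rintro ⟨h1, h2 | h2⟩
          · omega
          · exact hn ⟨h1, h2⟩
        · rcases (Nat.lt_succ_iff_lt_or_eq.1 hx) with h | rfl
          · exact hmax x h hPx
          · exact not_lt.1 fun h => hn ⟨hPx, h⟩

namespace Comp

variable {Γ : Type} [Ctx Γ] {N : Γ → ℤ}

theorem sumZ {f : Γ → ℤ → ℤ} (hN : Comp N) (hN' : PolyBdd fun γ => (N γ).toNat)
    (hf : Comp fun q : Γ × ℤ => f q.1 q.2) : Comp fun γ => sumZ (N γ) (f γ) := by
  obtain ⟨p, hp⟩ := hf.1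
  refine (Comp.iter_op (· + ·) bitLen_add (fun h h' => h.add h') (f := fun γ x _ => f γ x) 0 hN hN'
    hf.fst ((PolyBdd.size.add (hN'.add (.const 1))).eval p) fun γ x hx z => ?_).of_eq fun γ => ?_
  · refine (hp (γ, (x : ℤ))).trans (eval_mono p ?_)
    have := bitLen_le_natAbs (x : ℤ)
    change Ctx.size γ + bitLen (x : ℤ) ≤ _
    omega
  · rw [RAM.sumZ]
    induction (N γ).toNat with
    | zero => rfl
    | succ n ih => rw [Finset.sum_range_succ, ih, iter_succ]

theorem prodZ {f : Γ → ℤ → ℤ} (hN : Comp N) (hN' : PolyBdd fun γ => (N γ).toNat)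
    (hf : Comp fun q : Γ × ℤ => f q.1 q.2) : Comp fun γ => prodZ (N γ) (f γ) := by
  obtain ⟨p, hp⟩ := hf.1
  refine (Comp.iter_op (· * ·) bitLen_mul (fun h h' => h.mul h') (f := fun γ x _ => f γ x) 1 hN hN'
    hf.fst ((PolyBdd.size.add (hN'.add (.const 1))).eval p) fun γ x hx z => ?_).of_eq fun γ => ?_
  · refine (hp (γ, (x : ℤ))).trans (eval_mono p ?_)
    have := bitLen_le_natAbs (x : ℤ)
    change Ctx.size γ + bitLen (x : ℤ) ≤ _
    omega
  · rw [RAM.prodZ]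
    induction (N γ).toNat with
    | zero => rfl
    | succ n ih => rw [Finset.prod_range_succ, ih, iter_succ]

theorem argmaxZ {P : Γ → ℤ → Prop} {f : Γ → ℤ → ℤ} (hN : Comp N)
    (hN' : PolyBdd fun γ => (N γ).toNat) (hP : CompPred fun q : Γ × ℤ => P q.1 q.2)
    (hf : Comp fun q : Γ × ℤ => f q.1 q.2) : Comp fun γ => argmaxZ (N γ) (P γ) (f γ) := by
  classical
  have hx : Comp fun q : (Γ × ℤ) × ℤ => q.1.2 := Comp.snd.fst
  refine Comp.iter (f := fun γ x z => if P γ x ∧ (z < 0 ∨ f γ z < f γ x) then x else z)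
    hN hN' (.const (-1))
    (.ite (hP.fst.and (.or (.lt .snd (.const 0))
      (.lt (Comp.call hf IsPart.id.fst.fst .snd) hf.fst))) hx .snd)
    (hN'.add (.const 2)) fun γ k hk => ?_
  refine (bitLen_le_natAbs _).trans (Nat.succ_le_succ ?_)
  have := argmaxZ_spec k (P γ) (f γ)
  rw [RAM.argmaxZ, Int.toNat_natCast] at this
  rcases this with h | ⟨m, hm, h, -⟩
  · rw [h.1]; simp
  · rw [h]; simp; omega

end Comp

/-! ### The greedy algorithm in integer arithmetic -/

/-- The data of the greedy algorithm after scaling: the numbers of facilities and clients, the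
number `k` of steps, the distances `c i j`, the opening costs `f i` and the ground set `D`. Sets of
clients are encoded by integers, with client `j` as bit `j`. -/
structure GreedyData where
  nF : ℤ
  nC : ℤ
  k : ℤ
  c : ℤ → ℤ → ℤ
  f : ℤ → ℤ
  D : ℤ → Prop

namespace GreedyData

/-- `2 ^ j`, for `0 ≤ j ≤ nC`. -/
def pow (X : GreedyData) (j : ℤ) : ℤ := prodZ X.nC fun x => if x < j then 2 else 1

/-- Client `j` belongs to the set `M`. -/
def Mem (X : GreedyData) (M j : ℤ) : Prop := 0 < M / X.pow j - 2 * (M / X.pow j / 2)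

instance (X : GreedyData) (M j : ℤ) : Decidable (X.Mem M j) :=
  inferInstanceAs (Decidable (_ < _))

/-- The number of clients in `M` that are at most as far from facility `i` as client `j₀`. -/
noncomputable def count (X : GreedyData) (M i j₀ : ℤ) : ℤ :=
  sumZ X.nC fun j => if X.Mem M j ∧ X.c i j ≤ X.c i j₀ then 1 else 0

/-- The opening cost of facility `i` and the total distance of the clients in `M` that are at most
as far from it as client `j₀`. -/
noncomputable def total (X : GreedyData) (M i j₀ : ℤ) : ℤ :=
  X.f i + sumZ X.nC fun j => if X.Mem M j ∧ X.c i j ≤ X.c i j₀ then X.c i j else 0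

/-- The time at which facility `i` would be paid for by the clients in `M` that are at most as far
from it as client `j₀`. -/
noncomputable def avg (X : GreedyData) (M i j₀ : ℤ) : ℤ := X.total M i j₀ / X.count M i j₀

/-- The earliest of the times `avg`. -/
noncomputable def pay (X : GreedyData) (M i : ℤ) : ℤ :=
  X.avg M i (argmaxZ X.nC (fun j => X.Mem M j) fun j => -X.avg M i j)

/-- The time at which client `j` could be served by facility `i`. -/
noncomputable def shareAt (X : GreedyData) (M j i : ℤ) : ℤ := max (X.pay M i) (X.c i j)

/-- The cost share of client `j` in `M`. -/
noncomputable def share (X : GreedyData) (M j : ℤ) : ℤ :=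
  X.shareAt M j (argmaxZ X.nF (fun i => i = i) fun i => -X.shareAt M j i)

/-- The client that the greedy algorithm adds to `M`, or `-1` if there is none. -/
noncomputable def next (X : GreedyData) (M : ℤ) : ℤ :=
  argmaxZ X.nC (fun j => X.D j ∧ ¬ X.Mem M j) fun j => X.share (M + X.pow j) j

/-- The output of the greedy algorithm. -/
noncomputable def greedy (X : GreedyData) : ℤ :=
  iter X.nC.toNat 0 fun x M => M + if x < X.k ∧ 0 ≤ X.next M then X.pow (X.next M) else 0

/-- The total share of `M` plus `k` times the share of the client that could be added next. -/
noncomputable def value (X : GreedyData) (M : ℤ) : ℤ :=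
  (sumZ X.nC fun j => if X.Mem M j then X.share M j else 0) +
    X.k * if 0 ≤ X.next M then X.share (M + X.pow (X.next M)) (X.next M) else 0

/-- The data `𝒟 γ` can be computed in polynomial time. -/
structure IsComp {Γ : Type} [Ctx Γ] (𝒟 : Γ → GreedyData) : Prop where
  nF : Comp fun γ => (𝒟 γ).nF
  nC : Comp fun γ => (𝒟 γ).nC
  k : Comp fun γ => (𝒟 γ).k
  nF' : PolyBdd fun γ => (𝒟 γ).nF.toNat
  nC' : PolyBdd fun γ => (𝒟 γ).nC.toNat
  c : Comp fun q : (Γ × ℤ) × ℤ => (𝒟 q.1.1).c q.1.2 q.2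
  f : Comp fun q : Γ × ℤ => (𝒟 q.1).f q.2
  D : CompPred fun q : Γ × ℤ => (𝒟 q.1).D q.2

namespace IsComp

variable {Γ : Type} [Ctx Γ] {𝒟 : Γ → GreedyData} (h : IsComp 𝒟)
include h

theorem part {Δ : Type} [Ctx Δ] {π : Δ → Γ} (hπ : IsPart π) : IsComp fun δ => 𝒟 (π δ) where
  nF := h.nF.part hπ
  nC := h.nC.part hπ
  k := h.k.part hπ
  nF' := h.nF'.comp hπ.1
  nC' := h.nC'.comp hπ.1
  c := Comp.call₂ (F := fun γ => (𝒟 γ).c) h.c hπ.fst.fst Comp.snd.fst .snd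
  f := Comp.call (F := fun γ => (𝒟 γ).f) h.f hπ.fst .snd
  D := CompPred.call (P := fun γ => (𝒟 γ).D) h.D hπ.fst .snd

theorem fst : IsComp fun q : Γ × ℤ => 𝒟 q.1 := h.part IsPart.id.fst

variable {M i j : Γ → ℤ}

theorem comp_c (hi : Comp i) (hj : Comp j) : Comp fun γ => (𝒟 γ).c (i γ) (j γ) :=
  Comp.call₂ (F := fun γ => (𝒟 γ).c) h.c .id hi hj

theorem comp_f (hi : Comp i) : Comp fun γ => (𝒟 γ).f (i γ) :=
  Comp.call (F := fun γ => (𝒟 γ).f) h.f .id hi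

theorem pow (hj : Comp j) : Comp fun γ => (𝒟 γ).pow (j γ) :=
  Comp.prodZ (f := fun γ x => if x < j γ then 2 else 1) h.nC h.nC'
    (.ite (.lt .snd hj.fst) (.const 2) (.const 1))

theorem mem (hM : Comp M) (hj : Comp j) : CompPred fun γ => (𝒟 γ).Mem (M γ) (j γ) :=
  .lt (.const 0) (.sub (hM.div (h.pow hj)) (.mul (.const 2) ((hM.div (h.pow hj)).div (.const 2))))

theorem near (hM : Comp M) (hi : Comp i) {j₀ : Γ → ℤ} (hj₀ : Comp j₀) (hj : Comp j) :
    CompPred fun γ => (𝒟 γ).Mem (M γ) (j γ) ∧ (𝒟 γ).c (i γ) (j γ) ≤ (𝒟 γ).c (i γ) (j₀ γ) :=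
  (h.mem hM hj).and (.le (h.comp_c hi hj) (h.comp_c hi hj₀))

theorem avg (hM : Comp M) (hi : Comp i) (hj : Comp j) :
    Comp fun γ => (𝒟 γ).avg (M γ) (i γ) (j γ) :=
  .div (.add (h.comp_f hi) (Comp.sumZ h.nC h.nC'
      (.ite (h.fst.near hM.fst hi.fst hj.fst .snd) (h.fst.comp_c hi.fst .snd) (.const 0))))
    (Comp.sumZ h.nC h.nC' (.ite (h.fst.near hM.fst hi.fst hj.fst .snd) (.const 1) (.const 0)))

theorem pay (hM : Comp M) (hi : Comp i) : Comp fun γ => (𝒟 γ).pay (M γ) (i γ) :=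
  h.avg hM hi (Comp.argmaxZ h.nC h.nC' (h.fst.mem hM.fst .snd) (h.fst.avg hM.fst hi.fst .snd).neg)

theorem shareAt (hM : Comp M) (hj : Comp j) (hi : Comp i) :
    Comp fun γ => (𝒟 γ).shareAt (M γ) (j γ) (i γ) :=
  (h.pay hM hi).max (h.comp_c hi hj)

theorem share (hM : Comp M) (hj : Comp j) : Comp fun γ => (𝒟 γ).share (M γ) (j γ) :=
  h.shareAt hM hj
    (Comp.argmaxZ h.nF h.nF' (.eq .snd .snd) (h.fst.shareAt hM.fst hj.fst .snd).neg)

theorem next (hM : Comp M) : Comp fun γ => (𝒟 γ).next (M γ) :=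
  Comp.argmaxZ h.nC h.nC' (h.D.and (h.fst.mem hM.fst .snd).not)
    (h.fst.share (hM.fst.add (h.fst.pow .snd)) .snd)

theorem value (hM : Comp M) : Comp fun γ => (𝒟 γ).value (M γ) :=
  .add (Comp.sumZ h.nC h.nC' (.ite (h.fst.mem hM.fst .snd) (h.fst.share hM.fst .snd) (.const 0)))
    (.mul h.k (.ite (.le (.const 0) (h.next hM))
      (h.share (hM.add (h.pow (h.next hM))) (h.next hM)) (.const 0)))

theorem greedy : Comp fun γ => (𝒟 γ).greedy := by
  have hM : Comp fun q : (Γ × ℤ) × ℤ => q.2 := .snd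
  have hx : Comp fun q : (Γ × ℤ) × ℤ => q.1.2 := Comp.snd.fst
  have hn := h.fst.fst.next hM
  refine Comp.iter_op (· + ·) bitLen_add (fun h h' => h.add h')
    (f := fun γ x M => if x < (𝒟 γ).k ∧ 0 ≤ (𝒟 γ).next M then (𝒟 γ).pow ((𝒟 γ).next M) else 0)
    0 h.nC h.nC' (.ite ((CompPred.lt hx h.k.fst.fst).and (.le (.const 0) hn))
      (h.fst.fst.pow hn) (.const 0)) (h.nC'.add (.const 2)) fun γ x _ M => ?_
  have hpow : ∀ j, ((𝒟 γ).pow j).natAbs ≤ 2 ^ (𝒟 γ).nC.toNat := by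
    intro j
    rw [GreedyData.pow, prodZ, ← Int.natAbsHom_apply, map_prod]
    refine (Finset.prod_le_pow_card _ _ 2 fun x _ => ?_).trans (by simp)
    rw [Int.natAbsHom_apply]; split_ifs <;> decide
  refine bitLen_le_of_lt (n := (𝒟 γ).nC.toNat + 1) ?_
  rw [pow_succ]
  have := Nat.two_pow_pos (𝒟 γ).nC.toNat
  split_ifs
  · have := hpow ((𝒟 γ).next M); omega
  · simp

end IsComp

end GreedyData

end RAM

/-! ### Cost shares as averages -/

namespace KMaxMinFL

variable (I : KMaxMinFL)

/-- The clients of `J` that are at most as far from facility `i` as client `j₀`. -/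
noncomputable def near (J : Finset (Fin I.nC)) (i : Fin I.nF) (j₀ : Fin I.nC) :
    Finset (Fin I.nC) :=
  J.filter fun j => I.dFC i j ≤ I.dFC i j₀

/-- The time at which facility `i` would be paid for by the clients in `near J i j₀`. -/
noncomputable def avgTime (J : Finset (Fin I.nC)) (i : Fin I.nF) (j₀ : Fin I.nC) : ℝ :=
  (I.f i + ∑ j ∈ I.near J i j₀, I.dFC i j) / (I.near J i j₀).card

variable {I}

theorem mem_near_self {J : Finset (Fin I.nC)} (i : Fin I.nF) {j₀ : Fin I.nC} (h : j₀ ∈ J) :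
    j₀ ∈ I.near J i j₀ :=
  Finset.mem_filter.2 ⟨h, le_rfl⟩

theorem payTime_le_avgTime {J : Finset (Fin I.nC)} (i : Fin I.nF) {j₀ : Fin I.nC} (h : j₀ ∈ J) :
    I.payTime J i ≤ I.avgTime J i j₀ := by
  have hc : (0 : ℝ) < (I.near J i j₀).card := by
    exact_mod_cast Finset.card_pos.2 ⟨j₀, mem_near_self i h⟩
  have hf : (0 : ℝ) ≤ I.f i := by exact_mod_cast I.f_nonneg i
  refine I.payTime_le (div_nonneg (add_nonneg hf
    (Finset.sum_nonneg fun j _ => I.dFC_nonneg i j)) hc.le) ?_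
  calc (I.f i : ℝ) = ∑ j ∈ I.near J i j₀, (I.avgTime J i j₀ - I.dFC i j) := by
        rw [Finset.sum_sub_distrib, Finset.sum_const, nsmul_eq_mul, avgTime,
          mul_div_cancel₀ _ hc.ne']
        ring
    _ ≤ ∑ j ∈ I.near J i j₀, max 0 (I.avgTime J i j₀ - I.dFC i j) := by
        gcongr; exact le_max_right _ _
    _ ≤ _ := Finset.sum_le_sum_of_subset_of_nonneg (Finset.filter_subset _ _)
        fun _ _ _ => le_max_left _ _

/-- A facility that is paid for at time `t`, when `j` has reached it, is paid for by the clients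
that have reached it; these are the clients in `near J i j₀`, where `j₀` is the last of them. -/
theorem exists_avgTime_le {J : Finset (Fin I.nC)} {i : Fin I.nF} {j : Fin I.nC} (hj : j ∈ J)
    {t : ℝ} (hjt : I.dFC i j ≤ t) (ht : (I.f i : ℝ) ≤ I.paid J i t) :
    ∃ j₀ ∈ J, I.avgTime J i j₀ ≤ t := by
  obtain ⟨j₀, hj₀, hmax⟩ := Finset.exists_max_image (J.filter fun j' => I.dFC i j' ≤ t)
    (fun j' => I.dFC i j') ⟨j, Finset.mem_filter.2 ⟨hj, hjt⟩⟩
  obtain ⟨hj₀J, hj₀t⟩ := Finset.mem_filter.1 hj₀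
  have hS : I.near J i j₀ = J.filter fun j' => I.dFC i j' ≤ t := by
    ext j'
    simp only [near, Finset.mem_filter]
    exact ⟨fun h => ⟨h.1, h.2.trans hj₀t⟩, fun h => ⟨h.1, hmax j' (Finset.mem_filter.2 h)⟩⟩
  have hc : (0 : ℝ) < (I.near J i j₀).card := by
    exact_mod_cast Finset.card_pos.2 ⟨j₀, mem_near_self i hj₀J⟩
  refine ⟨j₀, hj₀J, ?_⟩
  rw [avgTime, div_le_iff₀ hc]
  have : I.paid J i t = ∑ j' ∈ I.near J i j₀, (t - I.dFC i j') := by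
    rw [hS, Finset.sum_filter]
    refine Finset.sum_congr rfl fun j' _ => ?_
    split_ifs with h
    · exact max_eq_right (sub_nonneg.2 h)
    · exact max_eq_left (by linarith)
  rw [this, Finset.sum_sub_distrib, Finset.sum_const, nsmul_eq_mul] at ht
  linarith

/-- For a client `j` of `J`, the earliest of the times `avgTime` can replace `payTime` in the
definition of the cost share. -/
theorem max_avgTime_eq {J : Finset (Fin I.nC)} {i : Fin I.nF} {j m : Fin I.nC} (hj : j ∈ J)
    (hm : m ∈ J) (hmin : ∀ j₀ ∈ J, I.avgTime J i m ≤ I.avgTime J i j₀) :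
    max (I.avgTime J i m) (I.dFC i j) = max (I.payTime J i) (I.dFC i j) := by
  refine le_antisymm (max_le ?_ (le_max_right _ _))
    (max_le_max (payTime_le_avgTime i hm) le_rfl)
  obtain ⟨j₀, hj₀, h⟩ := exists_avgTime_le hj (le_max_right (I.payTime J i) (I.dFC i j))
    ((I.le_paid_payTime ⟨j, hj⟩ i).trans (I.paid_mono_time J i (le_max_left _ _)))
  exact (hmin j₀ hj₀).trans h

end KMaxMinFL

/-! ### Correctness of the integer greedy algorithm -/

namespace RAM

open scoped Nat

/-- The integer that encodes a set of clients. -/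
def mask {n : ℕ} (J : Finset (Fin n)) : ℕ := ∑ j ∈ J, 2 ^ (j : ℕ)

theorem mask_insert {n : ℕ} {J : Finset (Fin n)} {j : Fin n} (h : j ∉ J) :
    mask (insert j J) = mask J + 2 ^ (j : ℕ) := by
  rw [mask, Finset.sum_insert h, add_comm]; rfl

theorem mask_div_mod {n : ℕ} (J : Finset (Fin n)) (j : Fin n) :
    mask J / 2 ^ (j : ℕ) % 2 = if j ∈ J then 1 else 0 := by
  have h : (mask J).testBit j ↔ j ∈ J := by
    have h1 : mask J = ∑ i ∈ J.map Fin.valEmbedding, 2 ^ i := by simp [mask]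
    rw [← Nat.mem_bitIndices, ← List.mem_toFinset, h1, Finset.toFinset_bitIndices_sum_two_pow]
    simp [Fin.val_inj]
  rw [Nat.testBit_eq_decide_div_mod_eq, decide_eq_true_iff] at h
  split_ifs with hj
  · exact h.2 hj
  · have := mt h.1 hj; omega

namespace GreedyData

variable {X : GreedyData} {I : KMaxMinFL} {D : Finset (Fin I.nC)} {L : ℕ}

/-- `X` is the instance `I`, scaled by the factor `L`, with the ground set `D` of clients. The
scaled values are divisible by `nC !`, so that the averages of the algorithm are integers. -/
structure Represents (X : GreedyData) (I : KMaxMinFL) (D : Finset (Fin I.nC)) (L : ℕ) : Prop where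
  pos : 0 < L
  nF : X.nF = I.nF
  nC : X.nC = I.nC
  k : X.k = I.k
  c : ∀ (i : Fin I.nF) (j : Fin I.nC), (X.c (i : ℕ) (j : ℕ) : ℝ) = L * I.dFC i j
  f : ∀ i : Fin I.nF, (X.f (i : ℕ) : ℝ) = L * I.f i
  dvd_c : ∀ (i : Fin I.nF) (j : Fin I.nC), ((I.nC)! : ℤ) ∣ X.c (i : ℕ) (j : ℕ)
  dvd_f : ∀ i : Fin I.nF, ((I.nC)! : ℤ) ∣ X.f (i : ℕ)
  D : ∀ j : Fin I.nC, X.D (j : ℕ) ↔ j ∈ D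

namespace Represents

variable (h : X.Represents I D L)
include h

theorem pos' : (0 : ℝ) < L := by exact_mod_cast h.pos

theorem pow_eq {j : ℕ} (hj : j < I.nC) : X.pow j = (2 ^ j : ℕ) := by
  rw [pow, prodZ, h.nC, Int.toNat_natCast, Finset.prod_ite, Finset.prod_const_one, mul_one,
    Finset.prod_const]
  have : (Finset.range I.nC).filter (fun x : ℕ => (x : ℤ) < j) = Finset.range j := by
    ext x; simp; omega
  rw [this, Finset.card_range]; push_cast; rfl

theorem mem_iff (J : Finset (Fin I.nC)) (j : Fin I.nC) : X.Mem (mask J) (j : ℕ) ↔ j ∈ J := by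
  rw [Mem, h.pow_eq j.2]
  have h1 := mask_div_mod J j
  have h2 : ((mask J : ℤ) / ((2 ^ (j : ℕ) : ℕ) : ℤ)) = ((mask J / 2 ^ (j : ℕ) : ℕ) : ℤ) := by
    push_cast; rfl
  rw [h2]
  split_ifs at h1 with hj
  · simp only [hj, iff_true]; omega
  · simp only [hj, iff_false]; omega

theorem sumZ_eq (g : ℤ → ℤ) : sumZ X.nC g = ∑ j : Fin I.nC, g (j : ℕ) := by
  rw [h.nC, sumZ_natCast]

theorem c_le_iff (i : Fin I.nF) (j j' : Fin I.nC) :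
    X.c (i : ℕ) (j : ℕ) ≤ X.c (i : ℕ) (j' : ℕ) ↔ I.dFC i j ≤ I.dFC i j' := by
  rw [← Int.cast_le (R := ℝ), h.c, h.c]
  exact mul_le_mul_iff_of_pos_left h.pos'

theorem count_eq (J : Finset (Fin I.nC)) (i : Fin I.nF) (j₀ : Fin I.nC) :
    X.count (mask J) (i : ℕ) (j₀ : ℕ) = (I.near J i j₀).card := by
  rw [count, h.sumZ_eq]
  simp only [h.mem_iff, h.c_le_iff]
  rw [Finset.sum_boole, KMaxMinFL.near]
  congr 2
  ext j; simp

theorem total_eq (J : Finset (Fin I.nC)) (i : Fin I.nF) (j₀ : Fin I.nC) :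
    X.total (mask J) (i : ℕ) (j₀ : ℕ) =
      X.f (i : ℕ) + ∑ j ∈ I.near J i j₀, X.c (i : ℕ) (j : ℕ) := by
  rw [total, h.sumZ_eq]
  simp only [h.mem_iff, h.c_le_iff]
  rw [← Finset.sum_filter, KMaxMinFL.near]
  congr 2
  ext j; simp

theorem avg_eq {J : Finset (Fin I.nC)} (i : Fin I.nF) {j₀ : Fin I.nC} (hj₀ : j₀ ∈ J) :
    (X.avg (mask J) (i : ℕ) (j₀ : ℕ) : ℝ) = L * I.avgTime J i j₀ := by
  have hc : 0 < (I.near J i j₀).card := Finset.card_pos.2 ⟨j₀, KMaxMinFL.mem_near_self i hj₀⟩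
  rw [avg, h.count_eq, h.total_eq, Int.cast_div _ (by exact_mod_cast hc.ne')]
  · push_cast
    simp only [h.c, h.f]
    rw [← Finset.mul_sum, ← mul_add, mul_div_assoc]; rfl
  · have h1 : (((I.near J i j₀).card : ℕ) : ℤ) ∣ ((I.nC)! : ℤ) := by
      exact_mod_cast Nat.dvd_factorial hc ((Finset.card_le_univ _).trans (by simp))
    exact h1.trans (dvd_add (h.dvd_f i) (Finset.dvd_sum fun j _ => h.dvd_c i j))

theorem shareAt_eq {J : Finset (Fin I.nC)} {j : Fin I.nC} (hj : j ∈ J) (i : Fin I.nF) :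
    (X.shareAt (mask J) (j : ℕ) (i : ℕ) : ℝ) = L * max (I.payTime J i) (I.dFC i j) := by
  rw [shareAt, pay, h.nC]
  rcases argmaxZ_spec I.nC (fun j => X.Mem (mask J) j) (fun j => -X.avg (mask J) (i : ℕ) j) with
    ⟨-, hno⟩ | ⟨m, hm, heq, hmem, hmax⟩
  · exact absurd ((h.mem_iff J j).2 hj) (hno j j.2)
  · have hmJ : (⟨m, hm⟩ : Fin I.nC) ∈ J := (h.mem_iff J ⟨m, hm⟩).1 hmem
    have ha := h.avg_eq i hmJ
    have : (m : ℤ) = ((⟨m, hm⟩ : Fin I.nC) : ℕ) := rfl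
    rw [heq, Int.cast_max, this, ha, h.c, ← mul_max_of_nonneg _ _ h.pos'.le,
      KMaxMinFL.max_avgTime_eq hj hmJ]
    intro j₀ hj₀
    have h1 := neg_le_neg_iff.1 (hmax j₀ j₀.2 ((h.mem_iff J j₀).2 hj₀))
    rw [this, ← Int.cast_le (R := ℝ), ha, h.avg_eq i hj₀] at h1
    exact le_of_mul_le_mul_left h1 h.pos'

theorem share_eq {J : Finset (Fin I.nC)} {j : Fin I.nC} (hj : j ∈ J) :
    (X.share (mask J) (j : ℕ) : ℝ) = L * I.costShare J j := by
  rw [share, h.nF]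
  rcases argmaxZ_spec I.nF (fun i => i = i) (fun i => -X.shareAt (mask J) (j : ℕ) i) with
    ⟨-, hno⟩ | ⟨m, hm, heq, -, hmax⟩
  · exact absurd rfl (hno 0 I.nF_pos)
  · have : (m : ℤ) = ((⟨m, hm⟩ : Fin I.nF) : ℕ) := rfl
    obtain ⟨i, hi⟩ := I.exists_costShare_eq hj
    rw [heq, this, h.shareAt_eq hj]
    congr 1
    refine le_antisymm ?_ (I.costShare_le hj _)
    have h1 := neg_le_neg_iff.1 (hmax i i.2 rfl)
    rw [this, ← Int.cast_le (R := ℝ), h.shareAt_eq hj, h.shareAt_eq hj, ← hi] at h1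
    exact le_of_mul_le_mul_left h1 h.pos'

theorem share_insert_eq {J : Finset (Fin I.nC)} {j : Fin I.nC} (hj : j ∉ J) :
    (X.share (mask J + X.pow (j : ℕ)) (j : ℕ) : ℝ) = L * I.costShare (insert j J) j := by
  rw [h.pow_eq j.2, ← Nat.cast_add, ← mask_insert hj, h.share_eq (Finset.mem_insert_self j J)]

theorem next_spec (J : Finset (Fin I.nC)) :
    (X.next (mask J) = -1 ∧ D ⊆ J) ∨ ∃ j ∈ D, j ∉ J ∧ X.next (mask J) = (j : ℕ) ∧
      ∀ j' ∈ D, j' ∉ J → I.costShare (insert j' J) j' ≤ I.costShare (insert j J) j := by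
  rw [next, h.nC]
  rcases argmaxZ_spec I.nC (fun j => X.D j ∧ ¬ X.Mem (mask J) j)
    (fun j => X.share (mask J + X.pow j) j) with ⟨heq, hno⟩ | ⟨m, hm, heq, hP, hmax⟩
  · refine Or.inl ⟨heq, fun j hj => ?_⟩
    by_contra hJ
    exact hno j j.2 ⟨(h.D j).2 hj, mt (h.mem_iff J j).1 hJ⟩
  · have hmJ : (⟨m, hm⟩ : Fin I.nC) ∉ J := mt (h.mem_iff J ⟨m, hm⟩).2 hP.2
    refine Or.inr ⟨⟨m, hm⟩, (h.D ⟨m, hm⟩).1 hP.1, hmJ, heq, fun j' hj' hJ' => ?_⟩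
    have h1 : X.share (mask J + X.pow (j' : ℕ)) (j' : ℕ) ≤
        X.share (mask J + X.pow ((⟨m, hm⟩ : Fin I.nC) : ℕ)) ((⟨m, hm⟩ : Fin I.nC) : ℕ) :=
      hmax j' j'.2 ⟨(h.D j').2 hj', mt (h.mem_iff J j').1 hJ'⟩
    rw [← Int.cast_le (R := ℝ), h.share_insert_eq hJ', h.share_insert_eq hmJ] at h1
    exact le_of_mul_le_mul_left h1 h.pos'

/-- The output of the algorithm is a set obtained by the greedy algorithm on `D`, which stops only
when it has `k` clients or contains all of `D`. -/
theorem greedy_spec : ∃ J : Finset (Fin I.nC), X.greedy = mask J ∧ I.GreedyOn D J.card J ∧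
    J.card ≤ I.k ∧ (J.card = I.k ∨ D ⊆ J) := by
  suffices H : ∀ n : ℕ, ∃ J : Finset (Fin I.nC), iter n 0 (fun x M =>
      M + if x < X.k ∧ 0 ≤ X.next M then X.pow (X.next M) else 0) = mask J ∧
      I.GreedyOn D J.card J ∧ J.card ≤ min n I.k ∧ (J.card = min n I.k ∨ D ⊆ J) by
    obtain ⟨J, h1, h2, h3, h4⟩ := H I.nC
    refine ⟨J, ?_, h2, h3.trans (min_le_right _ _), ?_⟩
    · rw [greedy, h.nC, Int.toNat_natCast, h1]
    · rcases h4 with h4 | h4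
      · rcases le_total I.k I.nC with hk | hk
        · left; rw [h4, min_eq_right hk]
        · right
          rw [(Finset.card_eq_iff_eq_univ J).1 (by rw [h4, min_eq_left hk, Fintype.card_fin])]
          exact Finset.subset_univ D
      · exact Or.inr h4
  intro n
  induction n with
  | zero => exact ⟨∅, by simp [mask], by simpa using KMaxMinFL.GreedyOn.zero, by simp, by simp⟩
  | succ n ih =>
    obtain ⟨J, h1, h2, h3, h4⟩ := ih
    rw [iter_succ, h1, h.k]
    by_cases hn : n < I.k
    · rcases h.next_spec J with ⟨hnext, hDJ⟩ | ⟨j, hjD, hjJ, hnext, hmax⟩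
      · refine ⟨J, by simp [hnext], h2, by omega, Or.inr hDJ⟩
      · have hcard := Finset.card_insert_of_notMem hjJ
        have h4' : J.card = min n I.k := h4.resolve_right fun hDJ => hjJ (hDJ hjD)
        refine ⟨insert j J, ?_, ?_, by omega, Or.inl (by omega)⟩
        · rw [if_pos ⟨by exact_mod_cast hn, by rw [hnext]; positivity⟩, hnext, h.pow_eq j.2,
            mask_insert hjJ]
          push_cast; rfl
        · rw [hcard]; exact .step h2 hjD hjJ hmax
    · refine ⟨J, ?_, h2, by omega, h4.imp_left fun h4 => by omega⟩
      rw [if_neg fun hc => hn (by exact_mod_cast hc.1), add_zero]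

theorem value_spec (J : Finset (Fin I.nC)) : ∃ τ : ℝ,
    (X.value (mask J) : ℝ) = L * (∑ j ∈ J, I.costShare J j + I.k * τ) ∧
    (∀ j ∈ D, j ∉ J → I.costShare (insert j J) j ≤ τ) ∧
    ((D ⊆ J ∧ τ = 0) ∨ ∃ j ∈ D, j ∉ J ∧ τ = I.costShare (insert j J) j) := by
  have hsum : ((sumZ X.nC fun j => if X.Mem (mask J) j then X.share (mask J) j else 0 : ℤ) : ℝ) =
      L * ∑ j ∈ J, I.costShare J j := by
    rw [h.sumZ_eq]
    simp only [h.mem_iff]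
    rw [← Finset.sum_filter, Finset.filter_univ_mem, Finset.mul_sum]
    push_cast
    exact Finset.sum_congr rfl fun j hj => h.share_eq hj
  rcases h.next_spec J with ⟨hnext, hDJ⟩ | ⟨j, hjD, hjJ, hnext, hmax⟩
  · refine ⟨0, ?_, fun j hj hJ => absurd (hDJ hj) hJ, Or.inl ⟨hDJ, rfl⟩⟩
    rw [value, Int.cast_add, hsum, hnext]; simp
  · refine ⟨_, ?_, hmax, Or.inr ⟨j, hjD, hjJ, rfl⟩⟩
    rw [value, Int.cast_add, hsum, hnext, if_pos (by positivity), Int.cast_mul,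
      h.share_insert_eq hjJ, h.k]
    push_cast; ring

/-- The output of the greedy algorithm, and its value, which up to a factor of `2` is a lower
bound for the fractional cost of the output and up to a factor of `3` an upper bound for the cost
of any other set of at most `k` clients in `D`. -/
theorem value_greedy : ∃ J : Finset (Fin I.nC), X.greedy = mask J ∧ J ⊆ D ∧ J.card ≤ I.k ∧
    (J.card = I.k ∨ D ⊆ J) ∧
    (∀ (f : Fin I.nF → ℚ) (x : Fin I.nF → ℝ), (∀ i, 0 ≤ x i) → (∀ i, (I.f i : ℝ) * x i = 0) →
      (∀ i, I.f i ≤ f i) → (X.value X.greedy : ℝ) ≤ L * (2 * I.fracCost f x J)) ∧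
    ∀ A ⊆ D, A.card ≤ I.k → L * I.intCost I.f A ≤ 3 * (X.value X.greedy : ℝ) := by
  obtain ⟨J, hJ, hgreedy, hk, hfull⟩ := h.greedy_spec
  obtain ⟨τ, hval, hmax, hτ⟩ := h.value_spec J
  have hτ0 : 0 ≤ τ := by
    rcases hτ with ⟨-, rfl⟩ | ⟨j, -, -, rfl⟩
    · exact le_rfl
    · exact I.costShare_nonneg _ _
  refine ⟨J, hJ, hgreedy.subset, hk, hfull, fun f x hx hfx hff => ?_, fun A hA hAk => ?_⟩
  · rw [hJ, hval]
    refine mul_le_mul_of_nonneg_left (hgreedy.le_two_mul_fracCost ?_ hx hfx hff) h.pos'.le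
    rcases hτ with ⟨-, h0⟩ | ⟨j, hjD, hjJ, hj⟩
    · exact Or.inl h0
    · exact Or.inr ⟨hfull.resolve_right fun hD => hjJ (hD hjD), j, hjD, hjJ, hj⟩
  · rw [hJ, hval]
    have := mul_le_mul_of_nonneg_left (I.intCost_le_of_share_le hτ0 hmax hA hAk) h.pos'.le
    linarith

end Represents

end GreedyData

end RAM

namespace RAM

open scoped Nat

/-! ### Reading the input and writing the output -/

theorem bitLen_getD_le (l : List ℤ) (i : ℕ) : bitLen (l.getD i 0) ≤ (l.map bitLen).sum + 1 := by
  rw [List.getD_eq_getElem?_getD]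
  cases h : l[i]? with
  | none => exact Nat.le_add_left _ _
  | some z =>
    exact (List.single_le_sum (fun _ _ => Nat.zero_le _) _
      (List.mem_map_of_mem (List.mem_of_getElem? h))).trans (Nat.le_succ _)

theorem Input.bitLen_scalar_le (w : Input) (v : ℕ) : bitLen (w.scalars.getD v 0) ≤ w.size + 1 :=
  (bitLen_getD_le _ v).trans (Nat.succ_le_succ (Nat.le_add_right _ _))

theorem Input.sum_array_le {w : Input} {l : List ℤ} (hl : l ∈ w.arrays) :
    (l.map bitLen).sum ≤ w.size :=
  (List.single_le_sum (fun _ _ => Nat.zero_le _) _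
    (List.mem_map_of_mem (f := fun l : List ℤ => (l.map bitLen).sum) hl)).trans
    (Nat.le_add_left _ _)

theorem Input.length_array_le {w : Input} {l : List ℤ} (hl : l ∈ w.arrays) : l.length ≤ w.size := by
  refine le_trans ?_ (Input.sum_array_le hl)
  have := List.length_le_sum_of_one_le (l.map bitLen) fun i hi => by
    obtain ⟨z, -, rfl⟩ := List.mem_map.1 hi
    exact one_le_bitLen z
  simpa using this

theorem Input.bitLen_arr_le (w : Input) (a : ℕ) (i : ℤ) :
    bitLen (w.initial.arr a i) ≤ w.size + 1 := by
  simp only [Input.initial]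
  split_ifs
  · refine (bitLen_getD_le _ _).trans (Nat.succ_le_succ ?_)
    rw [List.getD_eq_getElem?_getD]
    cases h : w.arrays[a - 1]? with
    | none => exact Nat.zero_le _
    | some l => exact Input.sum_array_le (List.mem_of_getElem? h)
  · exact Nat.le_add_left _ _

theorem Input.arr_eq (w : Input) {a : ℕ} (ha : 1 ≤ a) (i : ℕ) :
    w.initial.arr a i = (w.arrays.getD (a - 1) []).getD i 0 := by
  simp [Input.initial, ha]

/-- Inputs as data: the variables are the first `r` scalars. -/
abbrev inputCtx {α : Type} (enc : α → Input) (r : ℕ) : Ctx α where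
  ι := Fin r
  var v a := (enc a).scalars.getD v 0
  arr a := (enc a).initial.arr
  size a := (enc a).size

/-- A polynomial-time function whose values encode sets yields a program that outputs these sets:
it writes the binary digits of the value into array `0`. -/
theorem polyTimeComputesSet_of_comp {α : Type} {enc : α → Input} (r : ℕ) {m : α → ℕ}
    {P : (a : α) → Finset (Fin (m a)) → Prop} {F : α → ℤ}
    (hF : letI := inputCtx enc r; Comp F) (hm : letI := inputCtx enc r; Comp fun a => (m a : ℤ))
    (hm' : letI := inputCtx enc r; PolyBdd m) (hP : ∀ a, ∃ S, F a = mask S ∧ P a S) :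
    PolyTimeComputesSet enc m P := by
  let := inputCtx enc r
  obtain ⟨c, T, hT, hc⟩ := hm.2 r (fun v : Fin r => v) fun v => v.2
  obtain ⟨c', T', hT', hc'⟩ := hF.2 (r + 1) (fun v : Fin r => v) fun v => Nat.lt_succ_of_lt v.2
  set e : Expr := .sub (.reg r) (.reg (r + 2)) with he
  set digit : Expr := .sub (.reg (r + 1)) (.mul (.const 2) (.div (.reg (r + 1)) (.const 2)))
    with hdigit
  -- register `r + 1` holds the remaining digits, register `r + 2` counts the digits written
  set body : Program := .seq (.write 0 (.reg (r + 2)) digit)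
    (.seq (.assign (r + 1) (.div (.reg (r + 1)) (.const 2)))
      (.assign (r + 2) (.add (.reg (r + 2)) (.const 1)))) with hbody
  let B : α → ℕ := fun a => bitLen (F a) + (m a + 1)
  have hB : PolyBdd B := hF.1.add (hm'.add (.const 1))
  obtain ⟨p, hp⟩ : PolyBdd fun a => T a + (T' a + (2 + (m a + 1) *
      (4 * B a + 1 + (20 * B a + 30)))) :=
    hT.add (hT'.add ((PolyBdd.const 2).add ((hm'.add (.const 1)).mul
      ((((PolyBdd.const 4).mul hB).add (.const 1)).add
        (((PolyBdd.const 20).mul hB).add (.const 30))))))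
  refine ⟨.seq c (.seq c' (.seq (.assign (r + 2) (.const 0)) (.loop e body))), p, fun a => ?_⟩
  obtain ⟨S, hS, hPS⟩ := hP a
  have hdiv : ∀ k, bitLen ((mask S / 2 ^ k : ℕ) : ℤ) ≤ B a := fun k =>
    (bitLen_mono (by rw [hS, Int.natAbs_natCast, Int.natAbs_natCast]
                     exact Nat.div_le_self _ _)).trans (Nat.le_add_right _ _)
  have hkB : ∀ k ≤ m a, bitLen (k : ℤ) ≤ B a := fun k hk => by
    have := bitLen_le_natAbs (k : ℤ)
    change _ ≤ bitLen (F a) + (m a + 1)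
    omega
  let Inv : ℕ → State → Prop := fun k s => s.reg r = m a ∧
    s.reg (r + 1) = (mask S / 2 ^ k : ℕ) ∧ s.reg (r + 2) = k ∧
    ∀ j < k, s.arr 0 (j : ℕ) = (mask S / 2 ^ j % 2 : ℕ)
  have hinit : Holds (fun v : Fin r => (v : ℕ)) a (enc a).initial := ⟨fun _ => rfl, rfl⟩
  have key : Runs (.seq c (.seq c' (.seq (.assign (r + 2) (.const 0)) (.loop e body))))
      (enc a).initial (T a + (T' a + (2 + (m a + 1) * (4 * B a + 1 + (20 * B a + 30)))))
      (Inv (m a)) := by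
    refine (hc a _ hinit).seq fun s₁ h₁ =>
      (hc' a s₁ (hinit.of_eqBelow (fun v => v.2) h₁.2)).seq fun s₂ h₂ =>
      Runs.seq (T₁ := 2) (Q₁ := Inv 0) (Runs.assign ⟨?_, ?_, ?_, ?_⟩) fun s₃ h₃ =>
      Runs.loop (Inv := Inv) (T₀ := 4 * B a) (T := 20 * B a + 30) ?_ ?_ ?_ ?_ h₃
    · rw [setReg_reg_of_ne _ _ (by omega), h₂.2.1 _ (by omega), h₁.1]
    · rw [setReg_reg_of_ne _ _ (by omega), h₂.1, hS, pow_zero, Nat.div_one]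
    · simp [Expr.eval]
    · simp
    · rintro k hk s ⟨h₁, -, h₂, -⟩
      simp only [he, Expr.eval, h₁, h₂]; omega
    · rintro s ⟨h₁, -, h₂, -⟩
      simp only [he, Expr.eval, h₁, h₂]; omega
    · rintro k hk s ⟨h₁, -, h₂, -⟩
      simp only [he, Expr.cost, Expr.eval, h₁, h₂]
      have := bitLen_sub (m a : ℤ) k
      have := hkB k hk
      have := hkB (m a) le_rfl
      omega
    · rintro k hk s ⟨h₁, h₂, h₃, h₄⟩
      have hd := hdiv k
      have hd' := hdiv (k + 1)
      have hsucc : mask S / 2 ^ k / 2 = mask S / 2 ^ (k + 1) := by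
        rw [Nat.div_div_eq_div_mul, pow_succ]
      have hhalf : ((mask S / 2 ^ k : ℕ) : ℤ) / 2 = (mask S / 2 ^ (k + 1) : ℕ) := by
        rw [← hsucc]; rfl
      have hev : digit.eval s = (mask S / 2 ^ k % 2 : ℕ) := by
        simp only [hdigit, Expr.eval, h₂]; omega
      have hb2 : bitLen 2 = 3 := by decide
      have hb1 : bitLen 1 = 2 := by decide
      have hB1 : 1 ≤ B a := (one_le_bitLen _).trans hd
      refine (Runs.seq (Q₁ := fun s' => s'.reg r = m a ∧ s'.reg (r + 1) = (mask S / 2 ^ k : ℕ) ∧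
        s'.reg (r + 2) = k ∧ ∀ j < k + 1, s'.arr 0 (j : ℕ) = (mask S / 2 ^ j % 2 : ℕ))
        (T₂ := 7 * B a + 14) (Runs.write ⟨h₁, h₂, h₃, fun j hj => ?_⟩) fun s' h' =>
        ?_).mono ?_ fun _ h => h
      · rw [hev]
        simp only [State.setArr, Function.update_self, Expr.eval, h₃]
        rcases Nat.lt_succ_iff_lt_or_eq.1 hj with h | rfl
        · rw [Function.update_of_ne (by exact_mod_cast h.ne), h₄ j h]
        · rw [Function.update_self]
      · obtain ⟨h₁, h₂, h₃, h₄⟩ := h'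
        refine (Runs.seq (Q₁ := fun s' => s'.reg r = m a ∧
          s'.reg (r + 1) = (mask S / 2 ^ (k + 1) : ℕ) ∧ s'.reg (r + 2) = k ∧
          ∀ j < k + 1, s'.arr 0 (j : ℕ) = (mask S / 2 ^ j % 2 : ℕ)) (T₂ := 4 * B a + 6)
          (Runs.assign ⟨?_, ?_, ?_, h₄⟩) fun s'' h'' => ?_).mono ?_ fun _ h => h
        · rw [setReg_reg_of_ne _ _ (by omega), h₁]
        · simp [Expr.eval, h₂, ← hhalf]
        · rw [setReg_reg_of_ne _ _ (by omega), h₃]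
        · obtain ⟨h₁, h₂, h₃, h₄⟩ := h''
          refine (Runs.assign (Q := Inv (k + 1)) ⟨?_, ?_, ?_, h₄⟩).mono ?_ fun _ h => h
          · rw [setReg_reg_of_ne _ _ (by omega), h₁]
          · rw [setReg_reg_of_ne _ _ (by omega), h₂]
          · simp [Expr.eval, h₃]
          · simp only [Expr.cost, Expr.eval, h₃]
            have := hkB k hk.le
            have := bitLen_add (k : ℤ) 1
            omega
        · simp only [Expr.cost, Expr.eval, h₂, hhalf]
          omega
      · have hc1 : digit.cost s ≤ 6 * B a + 12 := by
          simp only [hdigit, Expr.cost, Expr.eval, h₂, hhalf]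
          have := bitLen_mul 2 ((mask S / 2 ^ (k + 1) : ℕ) : ℤ)
          have := bitLen_sub ((mask S / 2 ^ k : ℕ) : ℤ) (2 * ((mask S / 2 ^ (k + 1) : ℕ) : ℤ))
          omega
        have := hkB k hk.le
        simp only [Expr.cost, h₃]
        omega
  obtain ⟨s, t, hex, ht, -, -, -, hout⟩ := key
  refine ⟨s, t, hex, ht.trans (hp a), ?_⟩
  have : s.outputSet (m a) = S := by
    ext j
    rw [State.outputSet, Finset.mem_filter, hout j j.2, mask_div_mod]
    simp
  rwa [this]

/-! ### Clearing denominators -/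

/-- The product of the denominators of all distances and of the opening costs that are stored in
the arrays `a` and `a + 1`. -/
def scale (A : ℕ → ℤ → ℤ) (nF nC : ℤ) (a : ℕ) : ℤ :=
  (prodZ (nF + nC) fun u => prodZ (nF + nC) fun v => A 2 (u * (nF + nC) + v)) *
    prodZ nF fun i => A (a + 1) i

/-- The factorial of `nC`. -/
def factZ (nC : ℤ) : ℤ := prodZ nC fun x => x + 1

/-- The rational number in cell `i` of the arrays `b` and `b + 1`, scaled to an integer. -/
def ratZ (A : ℕ → ℤ → ℤ) (nF nC : ℤ) (a b : ℕ) (i : ℤ) : ℤ :=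
  factZ nC * (A b i * (scale A nF nC a / A (b + 1) i))

/-- The scaled distance of the points `u` and `v`. -/
def distZ (A : ℕ → ℤ → ℤ) (nF nC : ℤ) (a : ℕ) (u v : ℤ) : ℤ :=
  ratZ A nF nC a 1 (u * (nF + nC) + v)

/-- The arrays have polynomial bit lengths, and the numbers `nF` and `nC` are computable and
polynomially bounded. -/
structure IsFLCtx {Γ : Type} [Ctx Γ] (nF nC : Γ → ℤ) : Prop where
  read : ∀ a, PolyBdd fun q : Γ × ℤ => bitLen (Ctx.arr q.1 a q.2)
  nF' : PolyBdd fun γ => (nF γ).toNat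
  nC' : PolyBdd fun γ => (nC γ).toNat
  nF : Comp nF
  nC : Comp nC

namespace IsFLCtx

variable {Γ : Type} [Ctx Γ] {nF nC : Γ → ℤ} (h : IsFLCtx nF nC)
include h

theorem fst : IsFLCtx (fun q : Γ × ℤ => nF q.1) fun q => nC q.1 where
  read a := by
    have h1 : PolyBdd fun q : (Γ × ℤ) × ℤ => Ctx.size ((q.1.1, q.2) : Γ × ℤ) :=
      PolyBdd.size.mono fun q => by
        change Ctx.size q.1.1 + bitLen q.2 ≤ Ctx.size q.1.1 + bitLen q.1.2 + bitLen q.2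
        omega
    exact (h.read a).comp (π := fun q : (Γ × ℤ) × ℤ => (q.1.1, q.2)) h1
  nF := h.nF.fst
  nC := h.nC.fst
  nF' := h.nF'.comp IsPart.id.fst.1
  nC' := h.nC'.comp IsPart.id.fst.1

theorem arr (a : ℕ) {i : Γ → ℤ} (hi : Comp i) : Comp fun γ => Ctx.arr γ a (i γ) :=
  Comp.read (h.read a) hi

theorem scale (a : ℕ) : Comp fun γ => scale (Ctx.arr γ) (nF γ) (nC γ) a := by
  have hn := h.nF.add h.nC
  have hn' : PolyBdd fun γ => (nF γ + nC γ).toNat :=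
    (h.nF'.add h.nC').mono fun γ => by omega
  have hn₁' : PolyBdd fun q : Γ × ℤ => (nF q.1 + nC q.1).toNat := hn'.comp IsPart.id.fst.1
  refine .mul (Comp.prodZ (f := fun γ u => prodZ (nF γ + nC γ) fun v =>
    Ctx.arr γ 2 (u * (nF γ + nC γ) + v)) hn hn' ?_) (Comp.prodZ h.nF h.nF' (h.fst.arr _ .snd))
  exact Comp.prodZ (f := fun (q : Γ × ℤ) v => Ctx.arr q.1 2 (q.2 * (nF q.1 + nC q.1) + v))
    hn.fst hn₁' (h.fst.fst.arr 2 (.add (.mul Comp.snd.fst hn.fst.fst) .snd))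

theorem fact : Comp fun γ => factZ (nC γ) :=
  Comp.prodZ (f := fun _ x => x + 1) h.nC h.nC' (Comp.add .snd (.const 1))

theorem rat (a b : ℕ) {i : Γ → ℤ} (hi : Comp i) :
    Comp fun γ => ratZ (Ctx.arr γ) (nF γ) (nC γ) a b (i γ) :=
  h.fact.mul ((h.arr b hi).mul ((h.scale a).div (h.arr (b + 1) hi)))

theorem dist (a : ℕ) {u v : Γ → ℤ} (hu : Comp u) (hv : Comp v) :
    Comp fun γ => distZ (Ctx.arr γ) (nF γ) (nC γ) a (u γ) (v γ) :=
  h.rat a 1 ((hu.mul (h.nF.add h.nC)).add hv)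

end IsFLCtx

/-- The arrays `1` and `2` store the distances of `I`, and the arrays `a` and `a + 1` store the
opening costs `f`. -/
structure Stores (A : ℕ → ℤ → ℤ) (I : FLSpace) (a : ℕ) (f : Fin I.nF → ℚ) : Prop where
  dist_num : ∀ u v, A 1 ((finSumFinEquiv u : Fin (I.nF + I.nC)) * (I.nF + I.nC) +
    (finSumFinEquiv v : Fin (I.nF + I.nC))) = (I.dist u v).num
  dist_den : ∀ u v, A 2 ((finSumFinEquiv u : Fin (I.nF + I.nC)) * (I.nF + I.nC) +
    (finSumFinEquiv v : Fin (I.nF + I.nC))) = (I.dist u v).den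
  f_num : ∀ i : Fin I.nF, A a (i : ℕ) = (f i).num
  f_den : ∀ i : Fin I.nF, A (a + 1) (i : ℕ) = (f i).den

theorem prodZ_natCast (n : ℕ) (f : ℤ → ℤ) : prodZ n f = ∏ j : Fin n, f (j : ℕ) := by
  rw [prodZ, Int.toNat_natCast, Finset.prod_range]

theorem factZ_natCast (n : ℕ) : factZ n = (n ! : ℤ) := by
  rw [factZ, prodZ, Int.toNat_natCast, ← Finset.prod_range_add_one_eq_factorial]
  push_cast; rfl

namespace Stores

variable {A : ℕ → ℤ → ℤ} {I : FLSpace} {a : ℕ} {f : Fin I.nF → ℚ} (h : Stores A I a f)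
include h

theorem scale_eq : scale A I.nF I.nC a =
    (∏ u, ∏ v, ((I.dist u v).den : ℤ)) * ∏ i, ((f i).den : ℤ) := by
  have h1 : ∀ g : ℤ → ℤ, prodZ ((I.nF : ℤ) + I.nC) g =
      ∏ u, g (finSumFinEquiv u : Fin (I.nF + I.nC)) := by
    intro g
    rw [← Nat.cast_add, prodZ_natCast, ← finSumFinEquiv.prod_comp]
  simp only [scale, h1, prodZ_natCast, h.dist_den, h.f_den]

theorem scale_pos : 0 < scale A I.nF I.nC a := by
  rw [h.scale_eq]
  exact mul_pos (Finset.prod_pos fun u _ => Finset.prod_pos fun v _ => by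
    exact_mod_cast (I.dist u v).den_pos) (Finset.prod_pos fun i _ => by
    exact_mod_cast (f i).den_pos)

/-- The factor by which all numbers are scaled. -/
theorem exists_factor : ∃ L : ℕ, 0 < L ∧ (L : ℤ) = factZ I.nC * scale A I.nF I.nC a := by
  have : 0 < factZ I.nC * scale A I.nF I.nC a := by
    rw [factZ_natCast]
    exact mul_pos (by exact_mod_cast Nat.factorial_pos _) h.scale_pos
  exact ⟨(factZ I.nC * scale A I.nF I.nC a).toNat, by omega, by omega⟩

omit h in
theorem ratZ_eq {b : ℕ} {i : ℤ} {q : ℚ} (hn : A b i = q.num) (hd : A (b + 1) i = q.den)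
    (hdvd : (q.den : ℤ) ∣ scale A I.nF I.nC a) {L : ℕ}
    (hL : (L : ℤ) = factZ I.nC * scale A I.nF I.nC a) :
    (ratZ A I.nF I.nC a b i : ℝ) = L * q := by
  have hL' : (L : ℝ) = factZ I.nC * scale A I.nF I.nC a := by exact_mod_cast hL
  have hq : (q.den : ℝ) ≠ 0 := by exact_mod_cast q.den_ne_zero
  rw [ratZ, hn, hd, hL', Int.cast_mul, Int.cast_mul, Int.cast_div hdvd (by exact_mod_cast hq),
    Rat.cast_def]
  push_cast
  field_simp

theorem distZ_eq {L : ℕ} (hL : (L : ℤ) = factZ I.nC * scale A I.nF I.nC a)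
    (u v : Fin I.nF ⊕ Fin I.nC) :
    (distZ A I.nF I.nC a (finSumFinEquiv u : Fin (I.nF + I.nC))
      (finSumFinEquiv v : Fin (I.nF + I.nC)) : ℝ) = L * (I.dist u v : ℝ) := by
  refine ratZ_eq (h.dist_num u v) (h.dist_den u v) ?_ hL
  rw [h.scale_eq]
  exact ((Finset.dvd_prod_of_mem _ (Finset.mem_univ v)).trans
    (Finset.dvd_prod_of_mem (fun u => ∏ v, ((I.dist u v).den : ℤ)) (Finset.mem_univ u))).mul_right _

theorem dFC_eq {L : ℕ} (hL : (L : ℤ) = factZ I.nC * scale A I.nF I.nC a) (i : Fin I.nF)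
    (j : Fin I.nC) : (distZ A I.nF I.nC a (i : ℕ) (I.nF + (j : ℕ)) : ℝ) = L * I.dFC i j := by
  have := h.distZ_eq hL (.inl i) (.inr j)
  simpa [FLSpace.dFC] using this

theorem dCC_eq {L : ℕ} (hL : (L : ℤ) = factZ I.nC * scale A I.nF I.nC a) (j j' : Fin I.nC) :
    (distZ A I.nF I.nC a (I.nF + (j : ℕ)) (I.nF + (j' : ℕ)) : ℝ) = L * I.dCC j j' := by
  have := h.distZ_eq hL (.inr j) (.inr j')
  simpa [FLSpace.dCC] using this

theorem f_eq {L : ℕ} (hL : (L : ℤ) = factZ I.nC * scale A I.nF I.nC a) (i : Fin I.nF) :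
    (ratZ A I.nF I.nC a a (i : ℕ) : ℝ) = L * (f i : ℝ) := by
  refine ratZ_eq (h.f_num i) (h.f_den i) ?_ hL
  rw [h.scale_eq]
  exact (Finset.dvd_prod_of_mem (fun i => ((f i).den : ℤ)) (Finset.mem_univ i)).mul_left _

end Stores

theorem factorial_dvd_ratZ (A : ℕ → ℤ → ℤ) (nF : ℤ) (nC a b : ℕ) (i : ℤ) :
    (nC ! : ℤ) ∣ ratZ A nF nC a b i := by
  rw [ratZ, factZ_natCast]; exact dvd_mul_right _ _

theorem getD_map_num (l : List ℚ) (i : ℕ) :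
    (l.map fun q => q.num).getD i 0 = (l.getD i 0).num := by
  simp only [List.getD_eq_getElem?_getD, List.getElem?_map]
  cases l[i]? <;> rfl

theorem getD_map_den (l : List ℚ) {i : ℕ} (hi : i < l.length) :
    (l.map fun q => (q.den : ℤ)).getD i 0 = ((l.getD i 0).den : ℤ) := by
  simp [List.getD_eq_getElem?_getD, hi]

theorem getD_ofFn {β : Type} {n : ℕ} (g : Fin n → β) (i : Fin n) (z : β) :
    (List.ofFn g).getD i z = g i := by
  rw [List.getD_eq_getElem _ _ (by simp)]; simp

theorem getD_distList (I : FLSpace) (u v : Fin I.nF ⊕ Fin I.nC) :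
    (finSumFinEquiv u : Fin (I.nF + I.nC)) * (I.nF + I.nC) +
      (finSumFinEquiv v : Fin (I.nF + I.nC)) < I.distList.length ∧
    I.distList.getD ((finSumFinEquiv u : Fin (I.nF + I.nC)) * (I.nF + I.nC) +
      (finSumFinEquiv v : Fin (I.nF + I.nC))) 0 = I.dist u v := by
  set p := finProdFinEquiv (finSumFinEquiv u, finSumFinEquiv v) with hp
  have hval : (finSumFinEquiv u : Fin (I.nF + I.nC)) * (I.nF + I.nC) +
      (finSumFinEquiv v : Fin (I.nF + I.nC)) = (p : ℕ) := by
    rw [hp, finProdFinEquiv_apply_val, mul_comm, add_comm]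
  rw [hval, FLSpace.distList]
  refine ⟨by rw [List.length_ofFn]; exact p.2, ?_⟩
  rw [getD_ofFn, hp]
  simp

/-- An input whose first two arrays store the distances of `I`, and whose arrays `a` and `a + 1`
store the opening costs `f`. -/
theorem stores_of_arrays (w : Input) (I : FLSpace) {a : ℕ} (ha : 1 ≤ a) (f : Fin I.nF → ℚ)
    (h₁ : w.arrays.getD 0 [] = I.distList.map fun q => q.num)
    (h₂ : w.arrays.getD 1 [] = I.distList.map fun q => (q.den : ℤ))
    (h₃ : w.arrays.getD (a - 1) [] = (List.ofFn f).map fun q => q.num)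
    (h₄ : w.arrays.getD a [] = (List.ofFn f).map fun q => (q.den : ℤ)) :
    Stores w.initial.arr I a f := by
  refine ⟨fun u v => ?_, fun u v => ?_, fun i => ?_, fun i => ?_⟩
  · have := w.arr_eq (a := 1) le_rfl ((finSumFinEquiv u : Fin (I.nF + I.nC)) * (I.nF + I.nC) +
      (finSumFinEquiv v : Fin (I.nF + I.nC)))
    push_cast at this
    rw [this, h₁, getD_map_num, (getD_distList I u v).2]
  · have := w.arr_eq (a := 2) (by norm_num) ((finSumFinEquiv u : Fin (I.nF + I.nC)) *
      (I.nF + I.nC) + (finSumFinEquiv v : Fin (I.nF + I.nC)))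
    push_cast at this
    rw [this, h₂, getD_map_den _ (getD_distList I u v).1, (getD_distList I u v).2]
  · rw [w.arr_eq ha, h₃, getD_map_num, getD_ofFn]
  · rw [w.arr_eq (Nat.le_add_left 1 a), Nat.add_sub_cancel, h₄, getD_map_den _ (by simp),
      getD_ofFn]

/-- The numbers of facilities and clients are at most the size of the list of distances. -/
theorem add_le_length_distList (I : FLSpace) : I.nF + I.nC ≤ I.distList.length := by
  rw [FLSpace.distList, List.length_ofFn]; exact Nat.le_mul_self _

theorem isFLCtx_input {α : Type} (enc : α → Input) {r : ℕ} (hr : 2 ≤ r) (I : α → FLSpace)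
    (hF : ∀ a, (enc a).scalars.getD 0 0 = (I a).nF) (hC : ∀ a, (enc a).scalars.getD 1 0 = (I a).nC)
    (hdist : ∀ a, ((I a).distList.map fun q => q.num) ∈ (enc a).arrays) :
    letI := inputCtx enc r
    IsFLCtx (fun a => ((I a).nF : ℤ)) fun a => ((I a).nC : ℤ) := by
  let := inputCtx enc r
  have hvar : ∀ v : Fin r, Comp fun a : α => Ctx.var v a := fun v =>
    Comp.var v ((PolyBdd.size.add (.const 1)).mono fun a => (enc a).bitLen_scalar_le v)
  have hle : ∀ a, (I a).nF + (I a).nC ≤ (enc a).size := fun a =>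
    ((add_le_length_distList (I a)).trans_eq (List.length_map _).symm).trans
      (Input.length_array_le (hdist a))
  exact ⟨fun b => ((PolyBdd.size.comp IsPart.id.fst.1).add (.const 1)).mono
      fun q => (enc q.1).bitLen_arr_le b q.2,
    PolyBdd.size.mono fun a => by have := hle a; change _ ≤ (enc a).size; omega,
    PolyBdd.size.mono fun a => by have := hle a; change _ ≤ (enc a).size; omega,
    (hvar ⟨0, by omega⟩).of_eq fun a => (hF a).symm,
    (hvar ⟨1, by omega⟩).of_eq fun a => (hC a).symm⟩

theorem comp_scalar {α : Type} (enc : α → Input) {r : ℕ} (v : Fin r) :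
    letI := inputCtx enc r
    Comp fun a => (enc a).scalars.getD v 0 :=
  let := inputCtx enc r
  Comp.var v ((PolyBdd.size.add (.const 1)).mono fun a => (enc a).bitLen_scalar_le v)

end RAM

/-! ### The algorithm for `k`-max-min facility location -/

namespace KMaxMinFL

instance : RAM.Ctx KMaxMinFL := RAM.inputCtx encode 3

theorem isFLCtx : RAM.IsFLCtx (fun I : KMaxMinFL => (I.nF : ℤ)) fun I => (I.nC : ℤ) :=
  RAM.isFLCtx_input encode (by norm_num) toFLSpace (fun _ => rfl) (fun _ => rfl)
    fun _ => List.mem_cons_self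

/-- The scaled instance, with all clients as the ground set. -/
def greedyData (I : KMaxMinFL) : RAM.GreedyData where
  nF := I.nF
  nC := I.nC
  k := I.k
  c i j := RAM.distZ (RAM.Ctx.arr I) I.nF I.nC 3 i (I.nF + j)
  f i := RAM.ratZ (RAM.Ctx.arr I) I.nF I.nC 3 3 i
  D j := j = j

theorem isComp_greedyData : RAM.GreedyData.IsComp greedyData where
  nF := isFLCtx.nF
  nC := isFLCtx.nC
  k := RAM.comp_scalar encode (r := 3) 2
  nF' := isFLCtx.nF'
  nC' := isFLCtx.nC'
  c := isFLCtx.fst.fst.dist 3 RAM.Comp.snd.fst (.add isFLCtx.nF.fst.fst .snd)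
  f := isFLCtx.fst.rat 3 3 .snd
  D := .eq .snd .snd

theorem stores (I : KMaxMinFL) : RAM.Stores (RAM.Ctx.arr I) I.toFLSpace 3 I.f :=
  RAM.stores_of_arrays I.encode I.toFLSpace (by norm_num) I.f rfl rfl rfl rfl

theorem exists_represents (I : KMaxMinFL) : ∃ L, I.greedyData.Represents I Finset.univ L := by
  obtain ⟨L, hL, hLeq⟩ := I.stores.exists_factor
  exact ⟨L, hL, rfl, rfl, rfl, I.stores.dFC_eq hLeq, I.stores.f_eq hLeq,
    fun _ _ => RAM.factorial_dvd_ratZ .., fun _ => RAM.factorial_dvd_ratZ .., fun j => by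
      simp [greedyData]⟩

theorem polyTime_greedy :
    RAM.PolyTimeComputesSet encode (fun I => I.nC) fun I S => I.IsGreedyOutput S := by
  refine RAM.polyTimeComputesSet_of_comp 3 isComp_greedyData.greedy isFLCtx.nC
    (isFLCtx.nC'.mono fun I => by simp) fun I => ?_
  obtain ⟨L, h⟩ := I.exists_represents
  obtain ⟨J, hJ, hgreedy, hk, hfull⟩ := h.greedy_spec
  refine ⟨J, hJ, ?_⟩
  have hcard : J.card = min I.k I.nC := by
    have hn : J.card ≤ I.nC := (Finset.card_le_univ J).trans_eq (Fintype.card_fin _)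
    rcases hfull with h | h
    · omega
    · rw [Finset.univ_subset_iff.1 h, Finset.card_univ, Fintype.card_fin] at hk ⊢
      omega
  rw [IsGreedyOutput, ← hcard]
  exact greedyOn_univ_iff.1 hgreedy

theorem IsGreedyOutput.isApprox {I : KMaxMinFL} {S : Finset (Fin I.nC)} (h : I.IsGreedyOutput S) :
    I.IsApprox (I.fracCost I.f 0) 6 S ∧ I.IsApprox (I.intCost I.f) 6 S := by
  have hg : I.GreedyOn Finset.univ (min I.k I.nC) S := greedyOn_univ_iff.2 h
  have hcard := hg.card_eq
  have hfull : S.card = I.k ∨ S = Finset.univ := by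
    rcases le_total I.k I.nC with hk | hk
    · left; omega
    · right; exact (Finset.card_eq_iff_eq_univ S).1 (by rw [Fintype.card_fin]; omega)
  -- `τ` is the largest share of a client outside of `S`
  obtain ⟨τ, hτ0, hmax, hτ⟩ : ∃ τ : ℝ, 0 ≤ τ ∧
      (∀ j ∈ Finset.univ, j ∉ S → I.costShare (insert j S) j ≤ τ) ∧
      (τ = 0 ∨ (S.card = I.k ∧ ∃ j ∈ Finset.univ, j ∉ S ∧ τ = I.costShare (insert j S) j)) := by
    by_cases hS : S = Finset.univ
    · exact ⟨0, le_rfl, fun j _ hj => absurd (hS ▸ Finset.mem_univ j) hj, Or.inl rfl⟩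
    · obtain ⟨j, hj, hmax⟩ := Finset.exists_max_image Sᶜ (fun j => I.costShare (insert j S) j)
        (by rwa [← Finset.compl_ne_univ_iff_nonempty, compl_compl])
      exact ⟨_, I.costShare_nonneg _ _, fun j' _ hj' => hmax j' (Finset.mem_compl.2 hj'),
        Or.inr ⟨hfull.resolve_right hS, j, Finset.mem_univ j, Finset.mem_compl.1 hj, rfl⟩⟩
  have hlow : ∑ j ∈ S, I.costShare S j + I.k * τ ≤ 2 * I.fracCost I.f 0 S :=
    hg.le_two_mul_fracCost hτ (fun _ => le_rfl) (fun _ => mul_zero _) fun _ => le_rfl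
  have hint : ∀ A, I.fracCost I.f 0 A ≤ I.intCost I.f A :=
    I.fracCost_le_intCost (fun _ => le_rfl) I.f_nonneg I.f_nonneg fun _ => Or.inl rfl
  have hupp : ∀ A : Finset (Fin I.nC), A.card ≤ I.k → I.intCost I.f A ≤ 6 * I.fracCost I.f 0 S :=
    fun A hA => by
      have := I.intCost_le_of_share_le hτ0 hmax (Finset.subset_univ A) hA
      linarith
  refine ⟨⟨by omega, fun A hA => ?_⟩, ⟨by omega, fun A hA => ?_⟩⟩
  · linarith [hupp A hA, hint A]
  · linarith [hupp A hA, hint S]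

end KMaxMinFL

/-! ### Scenario distances and radii -/

namespace FLSpace

variable (I : FLSpace)

/-- The radius around scenario `A` at which client `j` is reached: for the discrete metric, `0` for
the clients in `A` and `1` for all others; for the asymmetric metric, the distance of `j` from `A`.
It is `0` if `A` is empty, which matters only when distances are not penalized. -/
noncomputable def reach : ScenarioMetric → Finset (Fin I.nC) → Fin I.nC → ℝ
  | .discrete, A, j => if j ∈ A then 0 else 1
  | .asymInfty, A, j => if h : A.Nonempty then A.inf' h fun j' => I.dCC j j' else 0

theorem reach_nonneg (σ : ScenarioMetric) (A : Finset (Fin I.nC)) (j : Fin I.nC) :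
    0 ≤ I.reach σ A j := by
  cases σ with
  | discrete => rw [reach]; split_ifs <;> norm_num
  | asymInfty =>
    rw [reach]; split_ifs with h
    · exact (Finset.le_inf'_iff h _).2 fun j' _ => I.dCC_nonneg j j'
    · exact le_rfl

theorem ofReal_reach_le_scm (σ : ScenarioMetric) (A : Finset (Fin I.nC)) {B : Finset (Fin I.nC)}
    {j : Fin I.nC} (hj : j ∈ B) : ENNReal.ofReal (I.reach σ A j) ≤ I.scm σ A B := by
  cases σ with
  | discrete =>
    by_cases hA : j ∈ A
    · simp [reach, hA]
    · have : A ≠ B := fun h => hA (h ▸ hj)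
      simp [reach, scm, hA, this]
  | asymInfty =>
    rw [reach]; split_ifs with h
    · refine le_trans ?_ (le_iSup₂_of_le (f := fun j' (_ : j' ∈ B) =>
        ⨅ j ∈ A, ENNReal.ofReal (I.dCC j' j)) j hj le_rfl)
      exact le_iInf₂ fun j' hj' => ENNReal.ofReal_le_ofReal (Finset.inf'_le _ hj')
    · simp

/-- A set of clients within radius `r` of `A` has distance at most `r` from `A`. For the discrete
metric and `r < 1`, this needs that the set cannot be a proper subset of `A`. -/
theorem scm_le_ofReal {σ : ScenarioMetric} {A B : Finset (Fin I.nC)} {r : ℝ} {k : ℕ} (hr : 0 ≤ r)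
    (hA : σ = .asymInfty → A.Nonempty) (hB : ∀ j ∈ B, I.reach σ A j ≤ r) (hk : A.card ≤ k)
    (hfull : B.card = k ∨ ∀ j, I.reach σ A j ≤ r → j ∈ B) :
    I.scm σ A B ≤ ENNReal.ofReal r := by
  cases σ with
  | discrete =>
    rw [scm]
    split_ifs with hAB
    · exact bot_le
    · rw [← ENNReal.ofReal_one]
      refine ENNReal.ofReal_le_ofReal ?_
      by_contra! h1
      have hBA : B ⊆ A := fun j hj => by
        by_contra hjA
        have := hB j hj
        rw [reach, if_neg hjA] at this
        linarith
      refine hAB (Eq.symm ?_)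
      rcases hfull with h | h
      · exact Finset.eq_of_subset_of_card_le hBA (by omega)
      · exact hBA.antisymm fun j hj => h j (by rw [reach, if_pos hj]; exact hr)
  | asymInfty =>
    refine iSup₂_le fun j hj => ?_
    have hne := hA rfl
    obtain ⟨j', hj', heq⟩ := Finset.exists_mem_eq_inf' hne fun j' => I.dCC j j'
    refine iInf₂_le_of_le j' hj' (ENNReal.ofReal_le_ofReal ?_)
    have := hB j hj
    rwa [reach, dif_pos hne, heq] at this

end FLSpace

/-! ### The algorithm for `g(x, y, A)` -/

namespace GxyInput

instance : RAM.Ctx GxyInput := RAM.inputCtx encode 5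

theorem isFLCtx : RAM.IsFLCtx (fun N : GxyInput => (N.nF : ℤ)) fun N => (N.nC : ℤ) :=
  RAM.isFLCtx_input encode (by norm_num) (fun N => N.toFLSpace) (fun _ => rfl) (fun _ => rfl)
    fun _ => List.mem_cons_self

theorem stores (N : GxyInput) : RAM.Stores (RAM.Ctx.arr N) N.toFLSpace 5 N.f₂ :=
  RAM.stores_of_arrays N.encode N.toFLSpace (by norm_num) N.f₂ rfl rfl rfl rfl

theorem arr_opened (N : GxyInput) (i : Fin N.nF) :
    RAM.Ctx.arr N 7 (i : ℕ) = if i ∈ N.opened then 1 else 0 :=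
  (N.encode.arr_eq (by norm_num) i).trans (RAM.getD_ofFn _ i 0)

theorem arr_A (N : GxyInput) (j : Fin N.nC) :
    RAM.Ctx.arr N 8 (j : ℕ) = if j ∈ N.A then 1 else 0 :=
  (N.encode.arr_eq (by norm_num) j).trans (RAM.getD_ofFn _ j 0)

/-- The client of `A` that is closest to client `j`, or `-1` if `A` is empty. -/
noncomputable def nearest (N : GxyInput) (j : ℤ) : ℤ :=
  RAM.argmaxZ N.nC (fun j' => 0 < RAM.Ctx.arr N 8 j') fun j' =>
    -RAM.distZ (RAM.Ctx.arr N) N.nF N.nC 5 (N.nF + j) (N.nF + j')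

/-- The radius `reach`, scaled. -/
noncomputable def reachZ (N : GxyInput) : ScenarioMetric → ℤ → ℤ
  | .discrete, j =>
    if 0 < RAM.Ctx.arr N 8 j then 0 else RAM.factZ N.nC * RAM.scale (RAM.Ctx.arr N) N.nF N.nC 5
  | .asymInfty, j =>
    if N.nearest j < 0 then 0
    else RAM.distZ (RAM.Ctx.arr N) N.nF N.nC 5 (N.nF + j) (N.nF + N.nearest j)

/-- The number of greedy steps: if `A` is empty and distances are penalized, then all scenarios but
the empty one are infinitely far away in the asymmetric metric, and no step is made. -/
noncomputable def steps (N : GxyInput) : ScenarioMetric → ℤ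
  | .discrete => N.k
  | .asymInfty => if N.nearest 0 < 0 ∧ 0 < N.y.num then 0 else N.k

/-- The scaled instance in which the facilities opened in the first stage are free, with the clients
within radius `r` of `A` as the ground set. -/
noncomputable def greedyData (σ : ScenarioMetric) (q : GxyInput × ℤ) : RAM.GreedyData where
  nF := q.1.nF
  nC := q.1.nC
  k := q.1.steps σ
  c i j := RAM.distZ (RAM.Ctx.arr q.1) q.1.nF q.1.nC 5 i (q.1.nF + j)
  f i := if 0 < RAM.Ctx.arr q.1 7 i then 0 else RAM.ratZ (RAM.Ctx.arr q.1) q.1.nF q.1.nC 5 5 i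
  D j := q.1.reachZ σ j ≤ q.2

/-- The candidate radii: those of the clients, and the radius `0`. -/
noncomputable def radius (N : GxyInput) (σ : ScenarioMetric) (p : ℤ) : ℤ :=
  if p < N.nC then N.reachZ σ p else 0

/-- A multiple of the bound that the greedy algorithm certifies for candidate `p`, penalized by
the radius. -/
noncomputable def score (N : GxyInput) (σ : ScenarioMetric) (p : ℤ) : ℤ :=
  (greedyData σ (N, N.radius σ p)).value (greedyData σ (N, N.radius σ p)).greedy * N.y.den -
    2 * N.y.num * N.radius σ p

/-- The candidate with the best score. -/
noncomputable def best (N : GxyInput) (σ : ScenarioMetric) : ℤ :=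
  RAM.argmaxZ (N.nC + 1) (fun p => p = p) (N.score σ)

/-- The scenario that the algorithm returns. -/
noncomputable def output (N : GxyInput) (σ : ScenarioMetric) : ℤ :=
  (greedyData σ (N, N.radius σ (N.best σ))).greedy

section Comp

open RAM

theorem comp_nearest : Comp fun q : GxyInput × ℤ => q.1.nearest q.2 :=
  Comp.argmaxZ isFLCtx.nC.fst isFLCtx.fst.nC' (.lt (.const 0) (isFLCtx.fst.fst.arr 8 .snd))
    (isFLCtx.fst.fst.dist 5 (.add isFLCtx.nF.fst.fst Comp.snd.fst)
      (.add isFLCtx.nF.fst.fst .snd)).neg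

theorem comp_reachZ (σ : ScenarioMetric) : Comp fun q : GxyInput × ℤ => q.1.reachZ σ q.2 := by
  cases σ with
  | discrete =>
    exact .ite (.lt (.const 0) (isFLCtx.fst.arr 8 .snd)) (.const 0)
      (isFLCtx.fact.mul (isFLCtx.scale 5)).fst
  | asymInfty =>
    exact .ite (.lt comp_nearest (.const 0)) (.const 0)
      (isFLCtx.fst.dist 5 (.add isFLCtx.nF.fst .snd) (.add isFLCtx.nF.fst comp_nearest))

theorem comp_steps (σ : ScenarioMetric) : Comp fun N : GxyInput => N.steps σ := by
  have hk : Comp fun N : GxyInput => (N.k : ℤ) := comp_scalar encode (r := 5) 2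
  have hy : Comp fun N : GxyInput => N.y.num := comp_scalar encode (r := 5) 3
  cases σ with
  | discrete => exact hk
  | asymInfty =>
    exact .ite ((CompPred.lt (Comp.call comp_nearest .id (.const 0)) (.const 0)).and
      (.lt (.const 0) hy)) (.const 0) hk

theorem isComp_greedyData (σ : ScenarioMetric) : GreedyData.IsComp (greedyData σ) where
  nF := isFLCtx.nF.fst
  nC := isFLCtx.nC.fst
  k := (comp_steps σ).fst
  nF' := isFLCtx.fst.nF'
  nC' := isFLCtx.fst.nC'
  c := isFLCtx.fst.fst.fst.dist 5 Comp.snd.fst (.add isFLCtx.nF.fst.fst.fst .snd)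
  f := .ite (.lt (.const 0) (isFLCtx.fst.fst.arr 7 .snd)) (.const 0) (isFLCtx.fst.fst.rat 5 5 .snd)
  D := .le (Comp.call (F := fun (N : GxyInput) j => N.reachZ σ j) (comp_reachZ σ) IsPart.id.fst.fst .snd)
    Comp.snd.fst

theorem comp_greedy (σ : ScenarioMetric) :
    Comp fun q : GxyInput × ℤ => (greedyData σ (q.1, q.2)).greedy :=
  (isComp_greedyData σ).greedy

theorem comp_value (σ : ScenarioMetric) : Comp fun q : GxyInput × ℤ =>
    (greedyData σ (q.1, q.2)).value (greedyData σ (q.1, q.2)).greedy :=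
  (isComp_greedyData σ).value (comp_greedy σ)

theorem comp_radius (σ : ScenarioMetric) : Comp fun q : GxyInput × ℤ => q.1.radius σ q.2 :=
  .ite (.lt .snd isFLCtx.nC.fst) (comp_reachZ σ) (.const 0)

theorem comp_output (σ : ScenarioMetric) : Comp fun N : GxyInput => N.output σ := by
  have hy : Comp fun N : GxyInput => N.y.num := comp_scalar encode (r := 5) 3
  have hy' : Comp fun N : GxyInput => (N.y.den : ℤ) := comp_scalar encode (r := 5) 4
  have hscore : Comp fun q : GxyInput × ℤ => q.1.score σ q.2 :=
    .sub (.mul (Comp.call (F := fun N r => (greedyData σ (N, r)).value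
      (greedyData σ (N, r)).greedy) (comp_value σ) IsPart.id.fst (comp_radius σ)) hy'.fst)
      (.mul (.mul (.const 2) hy.fst) (comp_radius σ))
  have hbest : Comp fun N : GxyInput => N.best σ :=
    Comp.argmaxZ (isFLCtx.nC.add (.const 1))
      ((isFLCtx.nC'.add (.const 1)).mono fun N => by omega) (.eq .snd .snd) hscore
  exact Comp.call (F := fun N r => (greedyData σ (N, r)).greedy) (comp_greedy σ) .id
    (Comp.call (F := fun (N : GxyInput) p => N.radius σ p) (comp_radius σ) .id hbest)

end Comp

variable (N : GxyInput)

/-- The instance of `k`-max-min facility location in which the facilities opened in the first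
stage are free. -/
abbrev secondStage (k : ℕ) : KMaxMinFL where
  toFLSpace := N.toFLSpace
  f i := if i ∈ N.opened then 0 else N.f₂ i
  f_nonneg i := by split_ifs; exacts [le_rfl, N.f₂_nonneg i]
  k := k

theorem arr_A_pos (j : Fin N.nC) : 0 < RAM.Ctx.arr N 8 (j : ℕ) ↔ j ∈ N.A := by
  rw [arr_A]; split_ifs with h <;> simp [h]

theorem nearest_neg_iff (j : ℤ) : N.nearest j < 0 ↔ N.A = ∅ := by
  rw [nearest]
  rcases RAM.argmaxZ_spec N.nC (fun j' => 0 < RAM.Ctx.arr N 8 j') (fun j' =>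
    -RAM.distZ (RAM.Ctx.arr N) N.nF N.nC 5 (N.nF + j) (N.nF + j')) with
    ⟨h, hno⟩ | ⟨m, hm, h, hP, -⟩
  · rw [h]
    exact iff_of_true (by norm_num)
      (Finset.eq_empty_of_forall_notMem fun j hj => hno j j.2 ((N.arr_A_pos j).2 hj))
  · rw [h]
    exact iff_of_false (by omega)
      (Finset.ne_empty_of_mem ((N.arr_A_pos ⟨m, hm⟩).1 hP))

open Classical in
theorem steps_eq (σ : ScenarioMetric) :
    N.steps σ = if σ = .asymInfty ∧ N.A = ∅ ∧ 0 < N.y then (0 : ℕ) else N.k := by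
  cases σ with
  | discrete => simp [steps]
  | asymInfty => simp only [steps, nearest_neg_iff, Rat.num_pos, true_and]; split_ifs <;> rfl

theorem nearest_spec (j : Fin N.nC) : (N.nearest (j : ℕ) = -1 ∧ N.A = ∅) ∨
    ∃ m ∈ N.A, N.nearest (j : ℕ) = (m : ℕ) ∧ ∀ j' ∈ N.A, N.dCC j m ≤ N.dCC j j' := by
  obtain ⟨L, hL, hLeq⟩ := N.stores.exists_factor
  rcases RAM.argmaxZ_spec N.nC (fun j' => 0 < RAM.Ctx.arr N 8 j') (fun j' =>
    -RAM.distZ (RAM.Ctx.arr N) N.nF N.nC 5 (N.nF + (j : ℕ)) (N.nF + j')) with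
    ⟨h, hno⟩ | ⟨m, hm, h, hP, hmax⟩
  · exact Or.inl ⟨h, Finset.eq_empty_of_forall_notMem fun j hj => hno j j.2 ((N.arr_A_pos j).2 hj)⟩
  · refine Or.inr ⟨⟨m, hm⟩, (N.arr_A_pos ⟨m, hm⟩).1 hP, h, fun j' hj' => ?_⟩
    have h1 : RAM.distZ (RAM.Ctx.arr N) N.nF N.nC 5 (N.nF + (j : ℕ))
        (N.nF + ((⟨m, hm⟩ : Fin N.nC) : ℕ)) ≤ _ :=
      neg_le_neg_iff.1 (hmax j' j'.2 ((N.arr_A_pos j').2 hj'))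
    rw [← Int.cast_le (R := ℝ), N.stores.dCC_eq hLeq, N.stores.dCC_eq hLeq] at h1
    exact le_of_mul_le_mul_left h1 (by exact_mod_cast hL)

theorem reachZ_eq {L : ℕ}
    (hL : (L : ℤ) = RAM.factZ N.nC * RAM.scale (RAM.Ctx.arr N) N.nF N.nC 5) (σ : ScenarioMetric)
    (j : Fin N.nC) : (N.reachZ σ (j : ℕ) : ℝ) = L * N.reach σ N.A j := by
  cases σ with
  | discrete =>
    rw [reachZ, arr_A, FLSpace.reach, ← hL]
    by_cases h : j ∈ N.A <;> simp [h]
  | asymInfty =>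
    rw [reachZ, FLSpace.reach]
    rcases N.nearest_spec j with ⟨h, hA⟩ | ⟨m, hm, h, hmin⟩
    · simp [h, hA]
    · rw [h, if_neg (by omega), dif_pos ⟨m, hm⟩, N.stores.dCC_eq hL]
      congr 1
      exact le_antisymm ((Finset.le_inf'_iff _ _).2 hmin) (Finset.inf'_le _ hm)

/-- The clients within radius `r` of `A`, where `r` is scaled. -/
noncomputable def ball (σ : ScenarioMetric) (r : ℤ) : Finset (Fin N.nC) :=
  Finset.univ.filter fun j => N.reachZ σ (j : ℕ) ≤ r

theorem represents {L : ℕ} (hpos : 0 < L)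
    (hL : (L : ℤ) = RAM.factZ N.nC * RAM.scale (RAM.Ctx.arr N) N.nF N.nC 5) (σ : ScenarioMetric)
    (r : ℤ) {k : ℕ} (hk : N.steps σ = k) :
    (greedyData σ (N, r)).Represents (N.secondStage k) (N.ball σ r) L where
  pos := hpos
  nF := rfl
  nC := rfl
  k := hk
  c := N.stores.dFC_eq hL
  f i := by
    simp only [greedyData, arr_opened]
    by_cases h : i ∈ N.opened
    · simp [h]
    · simpa [h] using N.stores.f_eq hL i
  dvd_c _ _ := RAM.factorial_dvd_ratZ ..
  dvd_f i := by
    simp only [greedyData]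
    split_ifs
    · exact dvd_zero _
    · exact RAM.factorial_dvd_ratZ ..
  D j := by simp [ball, greedyData]

theorem x_nonneg (i : Fin N.nF) : 0 ≤ N.x i := by
  rw [x]; split_ifs <;> norm_num

theorem g_nonneg (B : Finset (Fin N.nC)) : 0 ≤ N.g N.x B :=
  N.fracCost_nonneg N.f₂_nonneg B

/-- The best candidate yields a scenario `B`, with a radius `r`, that compares favourably with every
scenario `A'` within any other candidate radius `r'`. -/
theorem output_spec (σ : ScenarioMetric) {k : ℕ} (hk : N.steps σ = k) :
    ∃ B : Finset (Fin N.nC), N.output σ = RAM.mask B ∧ B.card ≤ k ∧ ∃ r : ℝ, 0 ≤ r ∧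
      (∀ j ∈ B, N.reach σ N.A j ≤ r) ∧ (B.card = k ∨ ∀ j, N.reach σ N.A j ≤ r → j ∈ B) ∧
      ∀ r' : ℝ, (r' = 0 ∨ ∃ j, r' = N.reach σ N.A j) → ∀ A' : Finset (Fin N.nC), A'.card ≤ k →
        (∀ j ∈ A', N.reach σ N.A j ≤ r') → N.g N.x A' / 6 - N.y * r' ≤ N.g N.x B - N.y * r := by
  obtain ⟨L, hpos, hL⟩ := N.stores.exists_factor
  have hL0 : (0 : ℝ) < L := by exact_mod_cast hpos
  have hball : ∀ {p : ℤ} {r : ℝ}, (N.radius σ p : ℝ) = L * r →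
      ∀ j, j ∈ N.ball σ (N.radius σ p) ↔ N.reach σ N.A j ≤ r := by
    intro p r hr j
    rw [ball, Finset.mem_filter_univ, ← Int.cast_le (R := ℝ), hr, N.reachZ_eq hL]
    exact mul_le_mul_iff_of_pos_left hL0
  have hden : (0 : ℝ) < N.y.den := by exact_mod_cast N.y.den_pos
  have hy : (N.y.num : ℝ) = N.y * N.y.den := by
    have := N.y.mul_den_eq_num
    exact_mod_cast this.symm
  rcases RAM.argmaxZ_spec (N.nC + 1) (fun p => p = p) (N.score σ) with
    ⟨-, hno⟩ | ⟨p, hp, hbest, -, hmax⟩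
  · exact absurd rfl (hno 0 (Nat.succ_pos _))
  have hbest : N.best σ = p := by rw [best]; exact_mod_cast hbest
  obtain ⟨r, hr0, hr⟩ : ∃ r : ℝ, 0 ≤ r ∧ (N.radius σ p : ℝ) = L * r := by
    rw [radius]
    split_ifs with h
    · have h' : p < N.nC := by exact_mod_cast h
      exact ⟨_, N.reach_nonneg σ N.A ⟨p, h'⟩, N.reachZ_eq hL σ ⟨p, h'⟩⟩
    · exact ⟨0, le_rfl, by simp⟩
  obtain ⟨B, hB, hsub, hBk, hfull, hlow, -⟩ :=
    (N.represents hpos hL σ (N.radius σ p) hk).value_greedy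
  refine ⟨B, by rw [output, hbest, hB], hBk, r, hr0, fun j hj => (hball hr j).1 (hsub hj),
    hfull.imp_right fun h j hj => h ((hball hr j).2 hj), fun r' hr' A' hA'k hA' => ?_⟩
  obtain ⟨p', hp', hr'⟩ : ∃ p' < N.nC + 1, (N.radius σ (p' : ℕ) : ℝ) = L * r' := by
    rcases hr' with rfl | ⟨j, rfl⟩
    · exact ⟨N.nC, Nat.lt_succ_self _, by simp [radius]⟩
    · exact ⟨j, j.2.trans (Nat.lt_succ_self _), by
        rw [radius, if_pos (by exact_mod_cast j.2), N.reachZ_eq hL]⟩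
  obtain ⟨_, -, -, -, -, -, hupp⟩ := (N.represents hpos hL σ (N.radius σ p') hk).value_greedy
  have hupp' := hupp A' (fun j hj => (hball hr' j).2 (hA' j hj)) hA'k
  have hlow' := hlow N.f₂ N.x N.x_nonneg (fun i => by simp only [x]; split_ifs <;> simp) fun i => by
    dsimp only; split_ifs; exacts [N.f₂_nonneg i, le_rfl]
  have hint : N.g N.x A' ≤ N.intCost (N.secondStage k).f A' :=
    N.fracCost_le_intCost N.x_nonneg N.f₂_nonneg (N.secondStage k).f_nonneg (fun i => by
      simp only [x]; split_ifs <;> simp) A'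
  have hint' := mul_le_mul_of_nonneg_left hint hL0.le
  have hscore := hmax p' hp' rfl
  simp only [score] at hscore
  rw [← Int.cast_le (R := ℝ)] at hscore
  push_cast at hscore
  rw [hy, hr, hr'] at hscore
  set V : ℝ := ((greedyData σ (N, N.radius σ p)).value (greedyData σ (N, N.radius σ p)).greedy : ℝ)
  set V' : ℝ :=
    ((greedyData σ (N, N.radius σ p')).value (greedyData σ (N, N.radius σ p')).greedy : ℝ)
  have h1 : V' - 2 * N.y * (L * r') ≤ V - 2 * N.y * (L * r) :=
    le_of_mul_le_mul_right (by linarith) hden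
  have h2 : V ≤ L * (2 * N.g N.x B) := hlow'
  refine le_of_mul_le_mul_left ?_ hL0
  have h3 : (L : ℝ) * N.g N.x A' ≤ 3 * V' := hint'.trans hupp'
  linarith

/-- To compare penalized costs, distances may be replaced by an upper bound `r` for that of the
output and a lower bound `r'` for that of the other scenario. -/
theorem penalized_le {y a b r r' : ℝ} {s s' : ℝ≥0∞} (hy : 0 ≤ y) (hr : 0 ≤ r) (hr' : 0 ≤ r')
    (hs : s ≤ ENNReal.ofReal r) (hs' : ENNReal.ofReal r' ≤ s') (h : a - y * r' ≤ b - y * r) :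
    (a : EReal) - (y : EReal) * (s' : EReal) ≤ (b : EReal) - (y : EReal) * (s : EReal) := by
  have hy' : (0 : EReal) ≤ (y : EReal) := by exact_mod_cast hy
  have h1 : (s : EReal) ≤ (r : EReal) := by
    rw [← max_eq_left hr, ← EReal.coe_ennreal_ofReal]
    exact EReal.coe_ennreal_le_coe_ennreal_iff.2 hs
  have h2 : (r' : EReal) ≤ (s' : EReal) := by
    rw [← max_eq_left hr', ← EReal.coe_ennreal_ofReal]
    exact EReal.coe_ennreal_le_coe_ennreal_iff.2 hs'
  calc (a : EReal) - (y : EReal) * (s' : EReal) ≤ (a : EReal) - (y : EReal) * (r' : EReal) :=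
        EReal.sub_le_sub le_rfl (mul_le_mul_of_nonneg_left h2 hy')
    _ ≤ (b : EReal) - (y : EReal) * (r : EReal) := by exact_mod_cast h
    _ ≤ _ := EReal.sub_le_sub le_rfl (mul_le_mul_of_nonneg_left h1 hy')

theorem exists_isApprox_output (σ : ScenarioMetric) :
    ∃ B : Finset (Fin N.nC), N.output σ = RAM.mask B ∧ N.IsApprox σ 6 1 B := by
  have hy0 : (0 : ℝ) ≤ N.y := by exact_mod_cast N.y_nonneg
  have hsteps := N.steps_eq σ
  split_ifs at hsteps with hbad
  · obtain ⟨rfl, hA, hy⟩ := hbad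
    obtain ⟨B, hB, hB0, -⟩ := N.output_spec _ hsteps
    obtain rfl : B = ∅ := Finset.card_eq_zero.1 (Nat.le_zero.1 hB0)
    refine ⟨∅, hB, by simp, fun A' _ => ?_⟩
    rw [one_mul, hA]
    rcases A'.eq_empty_or_nonempty with rfl | ⟨j, hj⟩
    · exact penalized_le hy0 le_rfl le_rfl (by simp [FLSpace.scm]) (by simp)
        (by linarith [N.g_nonneg ∅])
    · have htop : N.scm .asymInfty ∅ A' = ⊤ := by
        rw [FLSpace.scm, eq_top_iff]
        exact le_iSup₂_of_le j hj (by simp)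
      rw [htop, EReal.coe_ennreal_top, EReal.coe_mul_top_of_pos (by exact_mod_cast hy),
        EReal.sub_top]
      exact bot_le
  · obtain ⟨B, hB, hBk, r, hr, hBr, hfull, hcmp⟩ := N.output_spec σ hsteps
    refine ⟨B, hB, hBk, fun A' hA' => ?_⟩
    -- `r'` is the smallest candidate radius that reaches all of `A'`
    obtain ⟨r', hr', hcand, hreach, hscm⟩ : ∃ r' : ℝ, 0 ≤ r' ∧
        (r' = 0 ∨ ∃ j, r' = N.reach σ N.A j) ∧ (∀ j ∈ A', N.reach σ N.A j ≤ r') ∧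
        ENNReal.ofReal r' ≤ N.scm σ N.A A' := by
      rcases A'.eq_empty_or_nonempty with rfl | hne
      · exact ⟨0, le_rfl, Or.inl rfl, by simp, by simp⟩
      · obtain ⟨j, hj, hmax⟩ := Finset.exists_max_image A' (N.reach σ N.A) hne
        exact ⟨_, N.reach_nonneg σ N.A j, Or.inr ⟨j, rfl⟩, hmax, N.ofReal_reach_le_scm σ N.A hj⟩
    have h := hcmp r' hcand A' hA' hreach
    rw [one_mul]
    by_cases hA : σ = .asymInfty ∧ N.A = ∅
    · have hy : N.y = 0 := le_antisymm (not_lt.1 fun h => hbad ⟨hA.1, hA.2, h⟩) N.y_nonneg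
      simp only [hy, Rat.cast_zero, zero_mul, sub_zero] at h
      simpa [hy] using h
    · exact penalized_le hy0 hr hr' (N.scm_le_ofReal hr (fun hσ =>
        Finset.nonempty_iff_ne_empty.2 fun h => hA ⟨hσ, h⟩) hBr N.card_A hfull) hscm h

theorem polyTime_isApprox (σ : ScenarioMetric) :
    RAM.PolyTimeComputesSet encode (fun N => N.nC) fun N B => N.IsApprox σ 6 1 B :=
  RAM.polyTimeComputesSet_of_comp 5 (comp_output σ) isFLCtx.nC
    (isFLCtx.nC'.mono fun N => by simp) fun N => N.exists_isApprox_output σ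

end GxyInput

theorem mainTheorem3 :
    -- a polynomial-time `(6, 1)`-approximation algorithm for `g(x, y, A)`, for both metrics
    (∀ σ : ScenarioMetric,
      RAM.PolyTimeComputesSet GxyInput.encode (fun N => N.nC)
        (fun N B => N.IsApprox σ 6 1 B)) ∧
    -- the greedy algorithm for `k`-max-min facility location runs in polynomial time
    RAM.PolyTimeComputesSet KMaxMinFL.encode (fun I => I.nC)
      (fun I S => I.IsGreedyOutput S) ∧
    -- its output is a 6-approximation for the fractional and for the integral problem
    (∀ (I : KMaxMinFL) (S : Finset (Fin I.nC)), I.IsGreedyOutput S →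
      I.IsApprox (I.fracCost I.f 0) 6 S ∧ I.IsApprox (I.intCost I.f) 6 S) := by
  exact ⟨GxyInput.polyTime_isApprox, KMaxMinFL.polyTime_greedy, fun _ _ h => h.isApprox⟩
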